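/- Let $q_n$ and $r_n=p_n-q_n$ be the numbers of relevant and irrelevant covariates at sample size $n$, with $q_n\to\infty$, $r_n\to\infty$. Let $\alpha_1,\alpha_3\in(-1,1)$ and $\alpha_2\in\mathbb R$ be constants such that, for every $n$, the block-exchangeable matrix $$C^n=\begin{pmatrix}C^n_{11}&C^n_{12}\\ C^n_{21}&C^n_{22}\end{pmatrix},\qquad (C^n_{11})_{ij}=\begin{cases}1&i=j\\ \alpha_1&i\ne j\end{cases},\quad (C^n_{22})_{ij}=\begin{cases}1&i=j\\ \alpha_3&i\ne j\end{cases},\quad (C^n_{12})_{ij}=(C^n_{21})_{ji}=\alpha_2,$$ with blocks of sizes $q_n$ and $r_n$, is positive definite. Put $D^n=(d_{ij})=(C^n)^{-1}$. For each $n$ we observe $y=X\beta+\varepsilon$, where $X$ is an $n\times p_n$ matrix with independent $N(0,C^n)$ rows, $\varepsilon\sim N(0,\sigma_n^2I_n)$ is independent of $X$, $\sigma_n>0$ is bounded in $n$, and $\beta=\beta^n\in\mathbb R^{p_n}$ has $\beta_j\neq0$ if and only if $j\le q_n$. Let $\gamma_j=\rho_js_j$ be the semi-standard partial covariance (SPAC)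 of the response $Y$ and the $j$-th covariate $X_j$: $\rho_j$ is the partial correlation of $Y$ and $X_j$ given the other covariates $X_{-j}$, and $s_j^2=\mathrm{Var}(Y\mid X_{-j})$. Let $m_n=|\sum_{i\le q_n}\mathrm{sign}(\beta_i)|$ and assume $m_n\to\infty$. Let $\underline L=\liminf_n q_n/m_n\in[1,\infty]$ (with $0\cdot\infty=0$ below). Given a tuning parameter $\lambda\ge 0$ and a random vector $\hat d=(\hat d_{11},\dots,\hat d_{p_np_n})$, a SPAC-Lasso estimate $\hat\gamma(\lambda)$ is any minimizer over $g\in\mathbb R^{p_n}$ of $$\tfrac12\Big\|y-\sum_{j}X_j\sqrt{\hat d_{jj}}\,g_j\Big\|^2+\lambda\sum_j\hat d_{jj}|g_j| .$$ Assume moreover the following regularity conditions. (i) For every $\delta>0$ there is $M>0$ such that, for large $n$, $\max_j|\hat d_{jj}-d_{jj}|\le M\sqrt{\log n/n}$ with probability at least $1-O(n^{-\delta})$. (ii) $p_n=O(n^\kappa)$ for some $\kappa\ge0$, and $q_n=o((n/\log n)^{1/3})$. (iii) There are positive $l_n\le\min_{j\le q_n}|\gamma_j|$ and nonnegative $\lambda_n$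 with $\sqrt{q_nn\log n}=o(\lambda_n)$, $\sqrt{q_n}\lambda_n/n\to0$ and $\sqrt{q_n}\lambda_n/n=o(l_n)$. Suppose that there is a constant $\eta>0$ with $$|\alpha_2|\le(1-\eta)\sqrt{\frac{1-\alpha_1}{1-\alpha_3}}\;\alpha_1\,\underline L .$$ Then the following hold. (a) The transformed strong irrepresentable condition holds: there is a constant $\eta'>0$ such that for all sufficiently large $n$, element-wise, $$\big|V(2)C^n_{21}(C^n_{11})^{-1}V(1)^{-1}\mathrm{sign}(\gamma_{(1)})\big|\le 1-\eta',$$ where $V(1)=\mathrm{diag}(\sqrt{1/d_{jj}})_{j\le q_n}$, $V(2)=\mathrm{diag}(\sqrt{1/d_{jj}})_{j>q_n}$, $\gamma_{(1)}=(\gamma_1,\dots,\gamma_{q_n})$. (b) SPAC-Lasso is strongly sign consistent: there is a data-independent sequence of tuning parameters (and the $\lambda_n$ of (iii) is one) along which, with probability tending to $1$, a minimizer $\hat\gamma(\lambda_n)$ exists and every minimizer satisfies $\mathrm{sign}(\hat\gamma(\lambda_n))=\mathrm{sign}(\gamma)$. -/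

import Mathlib

open MeasureTheory ProbabilityTheory Filter Topology Asymptotics Matrix

noncomputable section

/-- Covariance matrix of `(Y, X)` (with `none` the index of `Y`) when `Y = ∑ j, β j * X j + ε`,
`Cov X = C`, `Var ε = σ ^ 2` and `ε` is uncorrelated with `X`. -/
def jointCov {ι : Type*} [Fintype ι] (C : Matrix ι ι ℝ) (β : ι → ℝ) (σ : ℝ) :
    Matrix (Option ι) (Option ι) ℝ :=
  Matrix.of fun u v =>
    match u, v with
    | none, none => β ⬝ᵥ (C *ᵥ β) + σ ^ 2
    | none, some j => (C *ᵥ β) j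
    | some i, none => (C *ᵥ β) i
    | some i, some j => C i j

/-- Covariance of the errors of the best linear predictions of the variables `u` and `v` from
`X_{-j} = (X_k)_{k ≠ j}`, where `S` is the covariance matrix of `(Y, X)`. Under joint normality it is
the conditional covariance of `u` and `v` given `X_{-j}`. -/
def partialCov {ι : Type*} [Fintype ι] [DecidableEq ι] (S : Matrix (Option ι) (Option ι) ℝ)
    (j : ι) (u v : Option ι) : ℝ :=
  S u v - (fun k : {k : ι // k ≠ j} => S u (some k.1)) ⬝ᵥ
    ((S.submatrix (fun k : {k : ι // k ≠ j} => some k.1)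
        (fun k : {k : ι // k ≠ j} => some k.1))⁻¹ *ᵥ
      fun k : {k : ι // k ≠ j} => S (some k.1) v)

/-- Partial correlation `ρ_j` between the response and the `j`-th covariate. -/
def partialCorr {ι : Type*} [Fintype ι] [DecidableEq ι] (S : Matrix (Option ι) (Option ι) ℝ)
    (j : ι) : ℝ :=
  partialCov S j none (some j) /
    (√(partialCov S j none none) * √(partialCov S j (some j) (some j)))

/-- Semi-standard partial covariance (SPAC) `γ_j = ρ_j s_j`, with `s_j = √Var(Y | X_{-j})`. -/
def spac {ι : Type*} [Fintype ι] [DecidableEq ι] (S : Matrix (Option ι) (Option ι) ℝ)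
    (j : ι) : ℝ :=
  partialCorr S j * √(partialCov S j none none)

/-- The block-exchangeable covariance matrix of `q` relevant and `r` irrelevant covariates. -/
def exchangeableCov (q r : ℕ) (α₁ α₂ α₃ : ℝ) : Matrix (Fin q ⊕ Fin r) (Fin q ⊕ Fin r) ℝ :=
  Matrix.fromBlocks
    (Matrix.of fun i j => if i = j then 1 else α₁)
    (Matrix.of fun _ _ => α₂)
    (Matrix.of fun _ _ => α₂)
    (Matrix.of fun i j => if i = j then 1 else α₃)

/-- `m = |∑ sign (β_i)|`, the sum over the relevant covariates. -/
def signImbalance {q r : ℕ} (β : Fin q ⊕ Fin r → ℝ) : ℕ :=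
  (∑ i : Fin q, (SignType.sign (β (Sum.inl i)) : ℤ)).natAbs

/-- The vector `V(2) C₂₁ C₁₁⁻¹ V(1)⁻¹ sign(γ₍₁₎)`, where `V(1)` and `V(2)` are the diagonal matrices
with entries `√(1 / d_jj)`, `D = C⁻¹`, on the relevant and on the irrelevant covariates. -/
def transformedIrrepVector {q r : ℕ} (C : Matrix (Fin q ⊕ Fin r) (Fin q ⊕ Fin r) ℝ)
    (γ : Fin q ⊕ Fin r → ℝ) : Fin r → ℝ :=
  (Matrix.diagonal (fun j : Fin r => √(1 / C⁻¹ (Sum.inr j) (Sum.inr j))) * C.toBlocks₂₁ *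
    C.toBlocks₁₁⁻¹ *
    (Matrix.diagonal (fun i : Fin q => √(1 / C⁻¹ (Sum.inl i) (Sum.inl i))))⁻¹) *ᵥ
      fun i : Fin q => (SignType.sign (γ (Sum.inl i)) : ℝ)

/-- Transformed strong irrepresentable condition for growing dimensions: one constant `η > 0`
bounds all entries away from `1`, for all sufficiently large `n`. -/
def TransformedStrongIrrepresentable (q r : ℕ → ℕ)
    (C : ∀ n, Matrix (Fin (q n) ⊕ Fin (r n)) (Fin (q n) ⊕ Fin (r n)) ℝ)
    (γ : ∀ n, Fin (q n) ⊕ Fin (r n) → ℝ) : Prop :=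
  ∃ η : ℝ, 0 < η ∧ ∀ᶠ n in atTop, ∀ j, |transformedIrrepVector (C n) (γ n) j| ≤ 1 - η

/-- `n` independent `N(0, C)` rows and an independent `N(0, σ² I_n)` noise vector. -/
structure IsGaussianSample {Ω : Type*} [MeasurableSpace Ω] (μ : Measure Ω) {ι : Type*} [Fintype ι]
    [DecidableEq ι] {n : ℕ} (C : Matrix ι ι ℝ) (σ : ℝ)
    (x : Ω → Fin n → EuclideanSpace ℝ ι) (ε : Ω → Fin n → ℝ) : Prop where
  row_law : ∀ i, HasLaw (fun ω => x ω i) (multivariateGaussian 0 C) μ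
  row_indep : iIndepFun (fun i ω => x ω i) μ
  noise_law : ∀ i, HasLaw (fun ω => ε ω i) (gaussianReal 0 ⟨σ ^ 2, sq_nonneg σ⟩) μ
  noise_indep : iIndepFun (fun i ω => ε ω i) μ
  indep : IndepFun x ε μ

/-- The response `y = X β + ε`. -/
def response {ι : Type*} [Fintype ι] {n : ℕ} (x : Fin n → EuclideanSpace ℝ ι) (β : ι → ℝ)
    (ε : Fin n → ℝ) : Fin n → ℝ :=
  fun i => ∑ j, x i j * β j + ε i

/-- The SPAC-Lasso objective `½ ‖y - ∑ X_j √d̂_jj γ_j‖² + λ ∑ d̂_jj |γ_j|`. -/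
def spacLassoLoss {ι : Type*} [Fintype ι] {n : ℕ} (x : Fin n → EuclideanSpace ℝ ι)
    (y : Fin n → ℝ) (d : ι → ℝ) (lam : ℝ) (g : ι → ℝ) : ℝ :=
  1 / 2 * ∑ i, (y i - ∑ j, x i j * √(d j) * g j) ^ 2 + lam * ∑ j, d j * |g j|

/-- `g` is a SPAC-Lasso estimate: a global minimizer of the objective. -/
def IsSpacLasso {ι : Type*} [Fintype ι] {n : ℕ} (x : Fin n → EuclideanSpace ℝ ι)
    (y : Fin n → ℝ) (d : ι → ℝ) (lam : ℝ) (g : ι → ℝ) : Prop :=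
  ∀ h : ι → ℝ, spacLassoLoss x y d lam g ≤ spacLassoLoss x y d lam h

/-- With probability tending to one, SPAC-Lasso with the tuning parameters `lam n` has a solution
and every solution has the signs of `γ n`. (Stated as: the complementary event is asymptotically
null, so that the measurability of the set of `ω` plays no role.) -/
def SignConsistentAlong {Ω : Type*} [MeasurableSpace Ω] (μ : Measure Ω) (q r : ℕ → ℕ)
    (x : ∀ n, Ω → Fin n → EuclideanSpace ℝ (Fin (q n) ⊕ Fin (r n)))
    (y : ∀ n, Ω → Fin n → ℝ) (dhat : ∀ n, Ω → Fin (q n) ⊕ Fin (r n) → ℝ)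
    (γ : ∀ n, Fin (q n) ⊕ Fin (r n) → ℝ) (lam : ℕ → ℝ) : Prop :=
  Tendsto (fun n => μ {ω | ¬ ((∃ g, IsSpacLasso (x n ω) (y n ω) (dhat n ω) (lam n) g) ∧
    ∀ g, IsSpacLasso (x n ω) (y n ω) (dhat n ω) (lam n) g →
      ∀ j, SignType.sign (g j) = SignType.sign (γ n j))}) atTop (𝓝 0)

/-- Strong sign consistency: sign consistency along some data-independent choice of `λ_n`. -/
def StronglySignConsistent {Ω : Type*} [MeasurableSpace Ω] (μ : Measure Ω) (q r : ℕ → ℕ)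
    (x : ∀ n, Ω → Fin n → EuclideanSpace ℝ (Fin (q n) ⊕ Fin (r n)))
    (y : ∀ n, Ω → Fin n → ℝ) (dhat : ∀ n, Ω → Fin (q n) ⊕ Fin (r n) → ℝ)
    (γ : ∀ n, Fin (q n) ⊕ Fin (r n) → ℝ) : Prop :=
  ∃ lam : ℕ → ℝ, (∀ n, 0 ≤ lam n) ∧ SignConsistentAlong μ q r x y dhat γ lam

/-- Accuracy of the estimator `dhat` of the diagonal of the precision matrix: for every `δ > 0`
there is `M > 0` such that, for large `n`, `max_j |d̂_jj - d_jj| ≤ M √(log n / n)` holds with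
probability at least `1 - O(n^{-δ})`. -/
def PrecisionEstimatorAccurate {Ω : Type*} [MeasurableSpace Ω] (μ : Measure Ω) (q r : ℕ → ℕ)
    (C : ∀ n, Matrix (Fin (q n) ⊕ Fin (r n)) (Fin (q n) ⊕ Fin (r n)) ℝ)
    (dhat : ∀ n, Ω → Fin (q n) ⊕ Fin (r n) → ℝ) : Prop :=
  ∀ δ : ℝ, 0 < δ → ∃ M : ℝ, 0 < M ∧ ∃ K : ℝ, ∀ᶠ n : ℕ in atTop,
    μ {ω | ¬ ∀ j, |dhat n ω j - (C n)⁻¹ j j| ≤ M * √(Real.log n / n)} ≤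
      ENNReal.ofReal (K * (n : ℝ) ^ (-δ))

end

/-! Positive definiteness in every dimension pins down the parameters. On block-constant vectors
with block sums `u` and `w` the quadratic form of `C` tends to `u²α₁ + 2uwα₂ + w²α₃`, so `α₁, α₃ ≥
0` and `α₂² ≤ α₁α₃` (`exchangeable_parameters_of_posDef`).

For (a), the rows of `C₁₁` all sum to `1 - α₁ + qα₁`, hence `C₂₁ C₁₁⁻¹` is the constant matrix `α₂ /
(1 - α₁ + qα₁)`. The diagonal of `C⁻¹` is constant on each block, with values `a → 1/(1 - α₁)` and
`b → 1/(1 - α₃)`. Regressing out `X_{-j}` gives `γ_j = β_j / √d_jj`, so `γ` and `β` have the same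
signs. Every entry of the irrepresentable vector therefore has modulus `|α₂| m √a / ((1 - α₁ + qα₁)
√b)`, asymptotically `(|α₂|/α₁)(m/q) √((1 - α₃)/(1 - α₁))` when `α₂ ≠ 0`, and the assumption says
that its limsup is at most `1 - η` (`eventually_exchangeable_irrep_le`).

For (b), put `T = M √(log n / n)` and consider the event that all sample covariances among
covariates and noise, and all `d̂_jj`, are within order `T` of their targets. Chernoff bounds for
Gaussian squares, polarization and a union bound over `O(p²)` pairs, together with (i), give it
probability `1 - O(1/n)`. On this event the argument is deterministic
(`spacLasso_sign_of_deviation_le`): solve the Lasso equations on the relevant covariates with the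
signs of `β` prescribed, extend by zero, and verify strict KKT conditions, which make this vector
the unique minimizer. Signs survive because `√q λ/n` is small against the signal `l`. Strict dual
feasibility holds because the leading term is the irrepresentable vector, with slack `η'`, while the
errors are small against `λ/n`. -/

open scoped NNReal

/-! ### Chernoff bounds for squares and products of Gaussian variables -/

/-- Exponential moments of the square of a centred Gaussian variable. -/
lemma integral_exp_mul_sq_gaussianReal (v : ℝ≥0) {s : ℝ} (hs : 2 * s * v < 1) :
    ∫ x, Real.exp (s * x ^ 2) ∂(gaussianReal 0 v) = 1 / √(1 - 2 * s * v) := by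
  by_cases hv : v = 0
  · simp [hv, gaussianReal_zero_var]
  have hv' : (0 : ℝ) < v := by positivity
  rw [integral_gaussianReal_eq_integral_smul hv]
  have h1 : ∀ x : ℝ, gaussianPDFReal 0 v x • Real.exp (s * x ^ 2) =
      (√(2 * Real.pi * v))⁻¹ * Real.exp (-(1 / (2 * v) - s) * x ^ 2) := by
    intro x
    rw [gaussianPDFReal, smul_eq_mul, mul_assoc, ← Real.exp_add]
    congr 2
    field_simp
    ring
  simp_rw [h1]
  rw [integral_const_mul, integral_gaussian]
  have h2 : Real.pi / (1 / (2 * v) - s) = (2 * Real.pi * v) / (1 - 2 * s * v) := by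
    have h3 : (1 : ℝ) - 2 * s * v ≠ 0 := by linarith
    have h4 : 1 / (2 * (v : ℝ)) - s = (1 - 2 * s * v) / (2 * v) := by field_simp
    rw [h4]
    field_simp
  rw [h2, Real.sqrt_div (by positivity)]
  have h5 : √(2 * Real.pi * v) ≠ 0 := by positivity
  field_simp

/-- A nonintegrable function has integral `0` by convention, but the value just computed is
positive. -/
lemma integrable_exp_mul_sq_gaussianReal (v : ℝ≥0) {s : ℝ} (hs : 2 * s * v < 1) :
    Integrable (fun x => Real.exp (s * x ^ 2)) (gaussianReal 0 v) := by
  by_contra h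
  have h1 := integral_exp_mul_sq_gaussianReal v hs
  rw [integral_undef h] at h1
  have : 0 < 1 / √(1 - 2 * s * v) := by
    have : 0 < 1 - 2 * s * v := by linarith
    positivity
  linarith

/-- This is `-log (1 - y) ≤ y + y²` in exponential form. The linear lower bound for `exp` suffices
when `y ≤ 0`; for `y ≥ 0` the quadratic one is needed. -/
lemma one_le_one_sub_mul_exp {y : ℝ} (hy : |y| ≤ 1 / 2) :
    1 ≤ (1 - y) * Real.exp (y + y ^ 2) := by
  obtain ⟨h1, h2⟩ := abs_le.1 hy
  rcases le_total y 0 with h | h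
  · have := Real.add_one_le_exp (y + y ^ 2)
    have h3 : (1 - y) * (y + y ^ 2 + 1) ≤ (1 - y) * Real.exp (y + y ^ 2) :=
      mul_le_mul_of_nonneg_left this (by linarith)
    have h4 : 0 ≤ -y * y ^ 2 := mul_nonneg (by linarith) (sq_nonneg y)
    nlinarith
  · have := Real.quadratic_le_exp_of_nonneg (x := y + y ^ 2) (by positivity)
    have h3 := mul_le_mul_of_nonneg_left this (show 0 ≤ 1 - y by linarith)
    have h4 : 0 ≤ y ^ 2 * ((1 / 2 - y) * (1 + y + y ^ 2)) := by
      have : 0 ≤ 1 / 2 - y := by linarith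
      positivity
    nlinarith [pow_nonneg h 3, pow_nonneg h 4, pow_nonneg h 5]

lemma one_div_sqrt_one_sub_mul_exp_le {x : ℝ} (hx : |x| ≤ 1 / 4) :
    1 / √(1 - 2 * x) * Real.exp (-x) ≤ Real.exp (2 * x ^ 2) := by
  have hx2 : |2 * x| ≤ 1 / 2 := by rw [abs_mul, abs_two]; linarith
  have h := one_le_one_sub_mul_exp hx2
  obtain ⟨h1, h2⟩ := abs_le.1 hx
  have hpos : 0 < 1 - 2 * x := by linarith
  have h3 : 1 ≤ √(1 - 2 * x) * Real.exp (x + 2 * x ^ 2) := by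
    have : (√(1 - 2 * x) * Real.exp (x + 2 * x ^ 2)) ^ 2 =
        (1 - 2 * x) * Real.exp (2 * x + (2 * x) ^ 2) := by
      rw [mul_pow, Real.sq_sqrt hpos.le, ← Real.exp_nat_mul]
      congr 2
      push_cast
      ring
    rw [← this] at h
    exact (one_le_sq_iff₀ (by positivity)).1 h
  have hs : 0 < √(1 - 2 * x) := Real.sqrt_pos.2 hpos
  rw [div_mul_eq_mul_div, one_mul, div_le_iff₀ hs]
  calc Real.exp (-x) ≤ Real.exp (-x) * (√(1 - 2 * x) * Real.exp (x + 2 * x ^ 2)) :=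
        le_mul_of_one_le_right (Real.exp_pos _).le h3
    _ = (Real.exp (-x) * Real.exp (x + 2 * x ^ 2)) * √(1 - 2 * x) := by ring
    _ = Real.exp (2 * x ^ 2) * √(1 - 2 * x) := by rw [← Real.exp_add]; congr 2; ring

section
variable {Ω : Type*} [MeasurableSpace Ω] {μ : Measure Ω}

lemma integrable_exp_mul_centered_sq {U : Ω → ℝ} {v : ℝ≥0} (hU : HasLaw U (gaussianReal 0 v) μ)
    {s : ℝ} (hs : |s| * v ≤ 1 / 4) :
    Integrable (fun ω => Real.exp (s * (U ω ^ 2 - v))) μ := by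
  have h2 : 2 * s * v < 1 := by nlinarith [le_abs_self s, v.coe_nonneg]
  have h := integrable_exp_mul_sq_gaussianReal v h2
  rw [← hU.map_eq] at h
  have h3 := (h.comp_aemeasurable hU.aemeasurable).mul_const (Real.exp (-(s * v)))
  refine h3.congr (ae_of_all _ fun ω => ?_)
  simp only [Function.comp_apply, ← Real.exp_add]
  ring_nf

/-- Centred Gaussian squares are sub-exponential: for `|s| v ≤ 1/4` the exact moment `(1 -
2sv)^(-1/2) exp (-sv)` is dominated by a sub-Gaussian one. -/
lemma mgf_centered_sq_le {U : Ω → ℝ} {v : ℝ≥0} (hU : HasLaw U (gaussianReal 0 v) μ)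
    {s : ℝ} (hs : |s| * v ≤ 1 / 4) :
    mgf (fun ω => U ω ^ 2 - v) μ s ≤ Real.exp (2 * (s * v) ^ 2) := by
  have h2 : 2 * s * v < 1 := by nlinarith [le_abs_self s, v.coe_nonneg]
  have h := integral_exp_mul_sq_gaussianReal v h2
  have h3 := integrable_exp_mul_sq_gaussianReal v h2
  rw [← hU.map_eq] at h h3
  rw [integral_map hU.aemeasurable h3.aestronglyMeasurable] at h
  have h4 : mgf (fun ω => U ω ^ 2 - v) μ s =
      (∫ ω, Real.exp (s * U ω ^ 2) ∂μ) * Real.exp (-(s * v)) := by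
    rw [mgf, ← integral_mul_const]
    refine integral_congr_ae (ae_of_all _ fun ω => ?_)
    simp only [← Real.exp_add]
    ring_nf
  rw [h4, h, mul_assoc 2 s]
  exact one_div_sqrt_one_sub_mul_exp_le (by rwa [abs_mul, abs_of_nonneg v.coe_nonneg])

/-- Chernoff bound for the empirical second moment of independent centred Gaussian variables. -/
lemma measure_sum_sq_sub_ge_le [IsProbabilityMeasure μ] {n : ℕ} {U : Fin n → Ω → ℝ} {v : ℝ≥0}
    (hU : ∀ i, HasLaw (U i) (gaussianReal 0 v) μ) (hind : iIndepFun U μ)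
    {V t : ℝ} (hV : 0 < V) (hvV : v ≤ V) (ht0 : 0 ≤ t) (htV : t ≤ V) :
    μ {ω | n * t ≤ |∑ i, (U i ω ^ 2 - v)|} ≤
      ENNReal.ofReal (2 * Real.exp (-(n * t ^ 2 / (8 * V ^ 2)))) := by
  have hind2 : iIndepFun (fun i ω => U i ω ^ 2 - (v : ℝ)) μ :=
    hind.comp (fun _ x => x ^ 2 - (v : ℝ)) (fun _ => by fun_prop)
  have hmeas : ∀ i, AEMeasurable (fun ω => U i ω ^ 2 - (v : ℝ)) μ := fun i =>
    ((hU i).aemeasurable.pow_const 2).sub_const _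
  -- This `s` minimizes the Chernoff exponent `-s n t + 2 n (s V)²`; the assumption `t ≤ V` keeps it
  -- in the range `s v ≤ 1/4`.
  set s : ℝ := t / (4 * V ^ 2) with hs
  have hs0 : 0 ≤ s := by positivity
  have hsv : s * v ≤ 1 / 4 := by
    calc s * v ≤ s * V := by gcongr
      _ = t / V / 4 := by rw [hs]; field_simp
      _ ≤ 1 / 4 := by
        have : t / V ≤ 1 := (div_le_one hV).2 htV
        linarith
  have hmgf : ∀ s' : ℝ, |s'| = s → Integrable
      (fun ω => Real.exp (s' * (∑ i, fun ω => U i ω ^ 2 - (v : ℝ)) ω)) μ ∧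
      mgf (∑ i, fun ω => U i ω ^ 2 - (v : ℝ)) μ s' ≤ Real.exp (n * (2 * (s * V) ^ 2)) := by
    intro s' hs'
    have hsv' : |s'| * v ≤ 1 / 4 := by rwa [hs']
    constructor
    -- Nonintegrability would make the mgf of the sum `0`, but it is a product of positive mgfs.
    · by_contra hni
      have h0 := hind2.mgf_sum₀ (t := s') hmeas Finset.univ
      rw [mgf, integral_undef hni] at h0
      exact (Finset.prod_pos fun i _ =>
        mgf_pos (integrable_exp_mul_centered_sq (hU i) hsv')).ne h0
    · rw [hind2.mgf_sum₀ hmeas]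
      calc ∏ i : Fin n, mgf (fun ω => U i ω ^ 2 - (v : ℝ)) μ s'
          ≤ ∏ i : Fin n, Real.exp (2 * (s * V) ^ 2) := by
            refine Finset.prod_le_prod (fun i _ => mgf_nonneg) fun i _ => ?_
            refine (mgf_centered_sq_le (hU i) hsv').trans ?_
            rw [Real.exp_le_exp, mul_pow, ← sq_abs s', hs', mul_pow]
            gcongr
        _ = Real.exp (n * (2 * (s * V) ^ 2)) := by
            rw [Finset.prod_const, Finset.card_univ, Fintype.card_fin, ← Real.exp_nat_mul]
  have hexp : ∀ m : ℝ, m ≤ Real.exp (n * (2 * (s * V) ^ 2)) →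
      Real.exp (-s * (n * t)) * m ≤ Real.exp (-(n * t ^ 2 / (8 * V ^ 2))) := by
    intro m hm
    calc _ ≤ Real.exp (-s * (n * t)) * Real.exp (n * (2 * (s * V) ^ 2)) := by gcongr
      _ = _ := by
        rw [← Real.exp_add]
        congr 1
        rw [hs]
        field_simp
        ring
  set S : Ω → ℝ := ∑ i, fun ω => U i ω ^ 2 - (v : ℝ) with hS
  have hSapp : ∀ ω, ∑ i, (U i ω ^ 2 - (v : ℝ)) = S ω := fun ω => by simp [hS]
  have h1 : μ.real {ω | n * t ≤ S ω} ≤ Real.exp (-(n * t ^ 2 / (8 * V ^ 2))) := by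
    obtain ⟨hi, hm⟩ := hmgf s (abs_of_nonneg hs0)
    exact (measure_ge_le_exp_mul_mgf (n * t) hs0 hi).trans (hexp _ hm)
  have h2 : μ.real {ω | S ω ≤ -(n * t)} ≤ Real.exp (-(n * t ^ 2 / (8 * V ^ 2))) := by
    obtain ⟨hi, hm⟩ := hmgf (-s) (by rw [abs_neg, abs_of_nonneg hs0])
    refine (measure_le_le_exp_mul_mgf (-(n * t)) (by linarith) hi).trans ?_
    have := hexp _ hm
    rwa [show -(-s) * -(n * t) = -s * (n * t) by ring]
  have hsub : {ω | n * t ≤ |∑ i, (U i ω ^ 2 - v)|} ⊆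
      {ω | n * t ≤ S ω} ∪ {ω | S ω ≤ -(n * t)} := by
    intro ω hω
    simp only [Set.mem_ofPred_eq, hSapp, Set.mem_union] at hω ⊢
    rcases le_abs.1 hω with h | h
    · exact Or.inl h
    · exact Or.inr (by linarith)
  calc _ ≤ μ ({ω | n * t ≤ S ω} ∪ {ω | S ω ≤ -(n * t)}) := measure_mono hsub
    _ ≤ μ {ω | n * t ≤ S ω} + μ {ω | S ω ≤ -(n * t)} := measure_union_le _ _
    _ ≤ ENNReal.ofReal (Real.exp (-(n * t ^ 2 / (8 * V ^ 2)))) +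
        ENNReal.ofReal (Real.exp (-(n * t ^ 2 / (8 * V ^ 2)))) := by
      rw [← ofReal_measureReal (μ := μ) (s := {ω | n * t ≤ S ω}),
        ← ofReal_measureReal (μ := μ) (s := {ω | S ω ≤ -(n * t)})]
      gcongr
    _ = _ := by
      rw [← ENNReal.ofReal_add (by positivity) (by positivity)]
      congr 1
      ring

/-- Concentration of an empirical cross moment, by polarization. -/
lemma measure_sum_mul_sub_gt_le [IsProbabilityMeasure μ] {n : ℕ} {f g : Fin n → Ω → ℝ}
    {v₁ v₂ : ℝ≥0} (h₁ : ∀ i, HasLaw (fun ω => f i ω + g i ω) (gaussianReal 0 v₁) μ)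
    (h₂ : ∀ i, HasLaw (fun ω => f i ω - g i ω) (gaussianReal 0 v₂) μ)
    (hi₁ : iIndepFun (fun i ω => f i ω + g i ω) μ) (hi₂ : iIndepFun (fun i ω => f i ω - g i ω) μ)
    {V t c : ℝ} (hV : 0 < V) (hv₁ : v₁ ≤ V) (hv₂ : v₂ ≤ V) (ht0 : 0 ≤ t) (htV : t ≤ V)
    (hc : (v₁ : ℝ) - v₂ = 4 * c) :
    μ {ω | n * t < |∑ i, f i ω * g i ω - n * c|} ≤
      ENNReal.ofReal (4 * Real.exp (-(n * t ^ 2 / (8 * V ^ 2)))) := by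
  have b₁ := measure_sum_sq_sub_ge_le h₁ hi₁ hV hv₁ ht0 htV
  have b₂ := measure_sum_sq_sub_ge_le h₂ hi₂ hV hv₂ ht0 htV
  have hsub : {ω | n * t < |∑ i, f i ω * g i ω - n * c|} ⊆
      {ω | n * t ≤ |∑ i, ((f i ω + g i ω) ^ 2 - (v₁ : ℝ))|} ∪
      {ω | n * t ≤ |∑ i, ((f i ω - g i ω) ^ 2 - (v₂ : ℝ))|} := by
    intro ω hω
    by_contra hcon
    simp only [Set.mem_union, Set.mem_ofPred_eq, not_or, not_le] at hcon hω
    -- Polarization: `f g = ((f + g)² - (f - g)²) / 4`, and the centring `c` is the matching quarter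
    -- difference of variances.
    have e : ∑ i, f i ω * g i ω - n * c = 1 / 4 * (∑ i, ((f i ω + g i ω) ^ 2 - (v₁ : ℝ)) -
        ∑ i, ((f i ω - g i ω) ^ 2 - (v₂ : ℝ))) := by
      rw [← Finset.sum_sub_distrib]
      have : ∀ i, (f i ω + g i ω) ^ 2 - (v₁ : ℝ) - ((f i ω - g i ω) ^ 2 - (v₂ : ℝ)) =
          4 * (f i ω * g i ω) - 4 * c := fun i => by rw [← hc]; ring
      simp_rw [this, Finset.sum_sub_distrib, ← Finset.mul_sum]
      simp
      ring
    rw [e, abs_mul] at hω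
    have h4 := abs_sub (∑ i, ((f i ω + g i ω) ^ 2 - (v₁ : ℝ)))
      (∑ i, ((f i ω - g i ω) ^ 2 - (v₂ : ℝ)))
    have h5 : |(1 / 4 : ℝ)| = 1 / 4 := abs_of_pos (by norm_num)
    rw [h5] at hω
    have h6 := abs_nonneg (∑ i, ((f i ω + g i ω) ^ 2 - (v₁ : ℝ)))
    linarith
  calc _ ≤ _ := measure_mono hsub
    _ ≤ _ := measure_union_le _ _
    _ ≤ _ := add_le_add b₁ b₂
    _ = _ := by
      rw [← ENNReal.ofReal_add (by positivity) (by positivity)]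
      congr 1
      ring

/-- Pairing two independent families of independent variables gives an independent family. -/
lemma iIndepFun_prodMk_of_indepFun [IsProbabilityMeasure μ] {ι α δ : Type*} [Fintype ι]
    [MeasurableSpace α]
    [MeasurableSpace δ] {f : ι → Ω → α} {g : ι → Ω → δ} (hf : ∀ i, AEMeasurable (f i) μ)
    (hg : ∀ i, AEMeasurable (g i) μ) (hfi : iIndepFun f μ) (hgi : iIndepFun g μ)
    (hfg : IndepFun (fun ω i => f i ω) (fun ω i => g i ω) μ) :
    iIndepFun (fun i ω => (f i ω, g i ω)) μ := by
  have : ∀ i, IsProbabilityMeasure (μ.map (f i)) := fun i => Measure.isProbabilityMeasure_map (hf i)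
  have : ∀ i, IsProbabilityMeasure (μ.map (g i)) := fun i => Measure.isProbabilityMeasure_map (hg i)
  have hF : AEMeasurable (fun ω i => f i ω) μ := aemeasurable_pi_lambda _ hf
  have hG : AEMeasurable (fun ω i => g i ω) μ := aemeasurable_pi_lambda _ hg
  rw [iIndepFun_iff_map_fun_eq_pi_map (fun i => (hf i).prodMk (hg i))]
  have h1 : ∀ i, μ.map (fun ω => (f i ω, g i ω)) = (μ.map (f i)).prod (μ.map (g i)) := fun i =>
    (indepFun_iff_map_prod_eq_prod_map_map (hf i) (hg i)).1
      (hfg.comp (measurable_pi_apply i) (measurable_pi_apply i))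
  simp_rw [h1]
  have h2 := (indepFun_iff_map_prod_eq_prod_map_map hF hG).1 hfg
  rw [hfi.map_fun_eq_pi_map hf, hgi.map_fun_eq_pi_map hg] at h2
  -- A product of two product measures is, after regrouping coordinates, the product of the pairwise
  -- products.
  have h3 := (measurePreserving_arrowProdEquivProdArrow α δ ι (fun i => μ.map (f i))
    (fun i => μ.map (g i))).symm.map_eq
  rw [← h3, ← h2, AEMeasurable.map_map_of_aemeasurable
    (MeasurableEquiv.measurable _).aemeasurable (hF.prodMk hG)]
  rfl

end

/-! ### Marginals of the Gaussian rows and concentration of single sample covariances -/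

lemma hasLaw_inner_multivariateGaussian {ι : Type*} [Fintype ι] [DecidableEq ι]
    {C : Matrix ι ι ℝ} (hC : C.PosSemidef) (w : EuclideanSpace ℝ ι) :
    HasLaw (fun x => inner ℝ w x) (gaussianReal 0 (w ⬝ᵥ C *ᵥ w).toNNReal)
      (multivariateGaussian 0 C) where
  aemeasurable := by fun_prop
  map_eq := by
    have h := IsGaussian.map_eq_gaussianReal (μ := multivariateGaussian 0 C) (innerSL ℝ w)
    have h1 : (fun x => inner ℝ w x) = ⇑(innerSL ℝ w) := by ext; simp
    rw [h1, h, ContinuousLinearMap.integral_comp_id_comm, integral_id_multivariateGaussian]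
    · congr 2
      · simp
      · rw [← h1, ← covarianceBilin_self IsGaussian.memLp_two_id,
          covarianceBilin_multivariateGaussian hC]
    · exact IsGaussian.integrable_id

/-- The values `s = 1` and `s = -1` feed the polarization bound; `s = 0` gives the law of one
coordinate. -/
lemma hasLaw_add_multivariateGaussian {ι : Type*} [Fintype ι] [DecidableEq ι]
    {C : Matrix ι ι ℝ} (hC : C.PosSemidef) (a b : ι) (s : ℝ) :
    HasLaw (fun x : EuclideanSpace ℝ ι => x a + s * x b)
      (gaussianReal 0 (C a a + s * (C a b + C b a) + s ^ 2 * C b b).toNNReal)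
      (multivariateGaussian 0 C) := by
  have h := hasLaw_inner_multivariateGaussian hC
    (EuclideanSpace.single a 1 + s • EuclideanSpace.single b 1)
  have e1 : (fun x : EuclideanSpace ℝ ι =>
      inner ℝ (EuclideanSpace.single a 1 + s • EuclideanSpace.single b 1) x) =
      fun x => x a + s * x b := by
    ext x
    simp [inner_add_left, inner_smul_left, EuclideanSpace.inner_single_left]
  have e2 : (EuclideanSpace.single a 1 + s • EuclideanSpace.single b 1 :
      EuclideanSpace ℝ ι).ofLp = Pi.single a 1 + s • Pi.single b 1 := by
    ext i; simp [Pi.single_apply]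
  rw [e1, e2] at h
  have e3 : (Pi.single a 1 + s • Pi.single b 1) ⬝ᵥ C *ᵥ (Pi.single a 1 + s • Pi.single b 1) =
      C a a + s * (C a b + C b a) + s ^ 2 * C b b := by
    simp [Matrix.mulVec_add, Matrix.mulVec_smul, add_dotProduct, dotProduct_add]
    ring
  rwa [e3] at h

lemma Matrix.PosSemidef.abs_apply_le_one {ι : Type*} [Fintype ι] [DecidableEq ι] {C : Matrix ι ι ℝ}
    (hC : C.PosSemidef) (h1 : ∀ i, C i i = 1) (a b : ι) : |C a b| ≤ 1 := by
  have e (s : ℝ) : 0 ≤ C a a + s * (C a b + C b a) + s ^ 2 * C b b := by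
    have := hC.dotProduct_mulVec_nonneg (Pi.single a 1 + s • Pi.single b 1)
    simp [Matrix.mulVec_add, Matrix.mulVec_smul, add_dotProduct, dotProduct_add] at this
    linarith
  have hs : C b a = C a b := by simpa using hC.isHermitian.apply a b
  have := e 1
  have := e (-1)
  rw [h1, h1, hs] at *
  rw [abs_le]
  constructor <;> linarith

section
variable {Ω : Type*} [MeasurableSpace Ω] {μ : Measure Ω} [IsProbabilityMeasure μ]
  {ι : Type*} [Fintype ι] [DecidableEq ι] {n : ℕ} {C : Matrix ι ι ℝ} {σ : ℝ}
  {x : Ω → Fin n → EuclideanSpace ℝ ι} {ε : Ω → Fin n → ℝ}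

/-- Concentration of the entries of the sample covariance matrix. -/
lemma IsGaussianSample.measure_gram_sub_gt_le (h : IsGaussianSample μ C σ x ε)
    (hC : C.PosSemidef) (h1 : ∀ i, C i i = 1) (a b : ι) {t : ℝ} (ht0 : 0 ≤ t) (ht : t ≤ 4) :
    μ {ω | n * t < |∑ i, x ω i a * x ω i b - n * C a b|} ≤
      ENNReal.ofReal (4 * Real.exp (-(n * t ^ 2 / 128))) := by
  have hs : C b a = C a b := by simpa using hC.isHermitian.apply a b
  obtain ⟨hl, hu⟩ := abs_le.1 (hC.abs_apply_le_one h1 a b)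
  have law (s : ℝ) (i : Fin n) := (hasLaw_add_multivariateGaussian hC a b s).comp (h.row_law i)
  have ind (s : ℝ) : iIndepFun (fun i ω => x ω i a + s * x ω i b) μ :=
    h.row_indep.comp (fun _ (y : EuclideanSpace ℝ ι) => y a + s * y b) (fun _ => by fun_prop)
  -- With unit variances, `Var (X_a ± X_b) = 2 ± 2 C_ab ≤ 4`; this is the choice `V = 4`, and `8 V²
  -- = 128`.
  have key := measure_sum_mul_sub_gt_le (μ := μ) (f := fun i ω => x ω i a)
    (g := fun i ω => x ω i b) (t := t) (c := C a b) (V := 4)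
    (fun i => (law 1 i).congr (ae_of_all _ fun ω => by simp))
    (fun i => (law (-1) i).congr (ae_of_all _ fun ω => by simp [sub_eq_add_neg]))
    (by simpa using ind 1) (by simpa [sub_eq_add_neg] using ind (-1)) (by norm_num)
    (by rw [Real.coe_toNNReal _ (by rw [h1, h1, hs]; linarith), h1, h1, hs]; linarith)
    (by rw [Real.coe_toNNReal _ (by rw [h1, h1, hs]; linarith), h1, h1, hs]; linarith)
    ht0 ht
    (by rw [Real.coe_toNNReal _ (by rw [h1, h1, hs]; linarith),
          Real.coe_toNNReal _ (by rw [h1, h1, hs]; linarith), h1, h1, hs]; ring)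
  norm_num at key ⊢
  exact key

/-- Concentration of the empirical covariances of the covariates and the noise. -/
lemma IsGaussianSample.measure_noise_gt_le (h : IsGaussianSample μ C σ x ε)
    (hC : C.PosSemidef) (h1 : ∀ i, C i i = 1) (a : ι) {V t : ℝ} (hV : 1 + σ ^ 2 ≤ V)
    (ht0 : 0 ≤ t) (ht : t ≤ V) :
    μ {ω | n * t < |∑ i, x ω i a * ε ω i|} ≤
      ENNReal.ofReal (4 * Real.exp (-(n * t ^ 2 / (8 * V ^ 2)))) := by
  have hxm (i) : AEMeasurable (fun ω => x ω i) μ := (h.row_law i).aemeasurable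
  have hem (i) : AEMeasurable (fun ω => ε ω i) μ := (h.noise_law i).aemeasurable
  have pair := iIndepFun_prodMk_of_indepFun hxm hem h.row_indep h.noise_indep h.indep
  have hxa (i : Fin n) : HasLaw (fun ω => x ω i a) (gaussianReal 0 1) μ := by
    have := (hasLaw_add_multivariateGaussian hC a a 0).comp (h.row_law i)
    simpa [Function.comp_def, h1] using this
  have hie (i : Fin n) : IndepFun (fun ω => x ω i a) (fun ω => ε ω i) μ :=
    h.indep.comp (φ := fun z : Fin n → EuclideanSpace ℝ ι => z i a) (ψ := fun z : Fin n → ℝ => z i)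
      (by fun_prop) (measurable_pi_apply i)
  have hneg (i : Fin n) : HasLaw (fun ω => -ε ω i)
      (gaussianReal 0 ⟨σ ^ 2, sq_nonneg σ⟩) μ := by
    have := gaussianReal_neg (h.noise_law i)
    rw [neg_zero] at this
    exact this
  have l1 (i : Fin n) : HasLaw (fun ω => x ω i a + ε ω i)
      (gaussianReal 0 (1 + ⟨σ ^ 2, sq_nonneg σ⟩)) μ := by
    refine ⟨(hxa i).aemeasurable.add (hem i), ?_⟩
    have := gaussianReal_add_gaussianReal_of_indepFun (hie i) (hxa i).map_eq
      (h.noise_law i).map_eq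
    rw [add_zero] at this
    exact this
  have l2 (i : Fin n) : HasLaw (fun ω => x ω i a - ε ω i)
      (gaussianReal 0 (1 + ⟨σ ^ 2, sq_nonneg σ⟩)) μ := by
    have hi2 : IndepFun (fun ω => x ω i a) (fun ω => -ε ω i) μ :=
      (hie i).comp measurable_id measurable_neg
    refine ⟨(hxa i).aemeasurable.sub (hem i), ?_⟩
    have := gaussianReal_add_gaussianReal_of_indepFun hi2 (hxa i).map_eq (hneg i).map_eq
    rw [add_zero] at this
    simp_rw [sub_eq_add_neg]
    exact this
  have ind1 : iIndepFun (fun i ω => x ω i a + ε ω i) μ :=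
    pair.comp (fun _ (y : EuclideanSpace ℝ ι × ℝ) => y.1 a + y.2) (fun _ => by fun_prop)
  have ind2 : iIndepFun (fun i ω => x ω i a - ε ω i) μ :=
    pair.comp (fun _ (y : EuclideanSpace ℝ ι × ℝ) => y.1 a - y.2) (fun _ => by fun_prop)
  have hV0 : 0 < V := by nlinarith [sq_nonneg σ]
  have key := measure_sum_mul_sub_gt_le (μ := μ) (f := fun i ω => x ω i a)
    (g := fun i ω => ε ω i) (t := t) (c := 0) l1 l2 ind1 ind2 hV0 hV hV ht0 ht (by simp)
  simpa using key
end

/-! ### The block-exchangeable matrix: inverse, precision diagonal and admissible parameters -/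

section
variable {q r : ℕ} {α₁ α₂ α₃ : ℝ}

lemma exchangeableCov_apply_self (i : Fin q ⊕ Fin r) : exchangeableCov q r α₁ α₂ α₃ i i = 1 := by
  cases i <;> simp [exchangeableCov]

/-- Spreading masses `u` and `w` evenly over the blocks makes the diagonal contribute only terms of
order `1/q` and `1/r`. -/
lemma exchangeableCov_quadForm (hq : 0 < q) (hr : 0 < r) (u w : ℝ) :
    (Sum.elim (fun _ => u / q) (fun _ => w / r)) ⬝ᵥ (exchangeableCov q r α₁ α₂ α₃ *ᵥ
      (Sum.elim (fun _ => u / q) (fun _ => w / r))) =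
    u ^ 2 * (α₁ + (1 - α₁) / q) + 2 * u * w * α₂ + w ^ 2 * (α₃ + (1 - α₃) / r) := by
  have hq' : (q : ℝ) ≠ 0 := by positivity
  have hr' : (r : ℝ) ≠ 0 := by positivity
  have e1 (m : ℕ) (a c : ℝ) (i : Fin m) :
      ∑ j, (if i = j then 1 else a) * c = m * (a * c) + (1 - a) * c := by
    have : ∀ j, (if i = j then (1 : ℝ) else a) * c = a * c + if i = j then (1 - a) * c else 0 := by
      intro j; split_ifs <;> ring
    simp_rw [this, Finset.sum_add_distrib]
    simp
  simp only [dotProduct, mulVec, Fintype.sum_sum_type, exchangeableCov, fromBlocks_apply₁₁,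
    fromBlocks_apply₁₂, fromBlocks_apply₂₁, fromBlocks_apply₂₂, of_apply, Sum.elim_inl,
    Sum.elim_inr, e1]
  simp only [Finset.sum_const, Finset.card_univ, Fintype.card_fin, nsmul_eq_mul]
  field_simp
  ring

/-- The common diagonal entry of the relevant block of the precision matrix (the irrelevant one
is obtained by exchanging the blocks). -/
noncomputable def exchangeablePrecDiag (q r : ℕ) (α₁ α₂ α₃ : ℝ) : ℝ :=
  1 / (1 - α₁) - (α₁ * (1 - α₃) + r * (α₁ * α₃ - α₂ ^ 2)) /
    ((1 - α₁) * ((1 - α₁ + q * α₁) * (1 - α₃ + r * α₃) - q * r * α₂ ^ 2))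

/-- The inverse has the same block symmetry. The quantity in `hΔ` is the determinant of the `2 × 2`
matrix by which `C` acts on block-constant vectors. -/
lemma exchangeableCov_inv (h₁ : α₁ < 1) (h₃ : α₃ < 1)
    (hΔ : (1 - α₁ + q * α₁) * (1 - α₃ + r * α₃) - q * r * α₂ ^ 2 ≠ 0) :
    (∀ i, (exchangeableCov q r α₁ α₂ α₃)⁻¹ (Sum.inl i) (Sum.inl i) =
      exchangeablePrecDiag q r α₁ α₂ α₃) ∧
    (∀ j, (exchangeableCov q r α₁ α₂ α₃)⁻¹ (Sum.inr j) (Sum.inr j) =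
      exchangeablePrecDiag r q α₃ α₂ α₁) := by
  have hΔ' : (1 - α₃ + r * α₃) * (1 - α₁ + q * α₁) - r * q * α₂ ^ 2 =
      (1 - α₁ + q * α₁) * (1 - α₃ + r * α₃) - q * r * α₂ ^ 2 := by ring
  unfold exchangeablePrecDiag
  rw [hΔ']
  set Δ := (1 - α₁ + q * α₁) * (1 - α₃ + r * α₃) - q * r * α₂ ^ 2 with hΔdef
  have h₁' : 1 - α₁ ≠ 0 := by linarith
  have h₃' : 1 - α₃ ≠ 0 := by linarith
  set B := (α₁ * (1 - α₃) + r * (α₁ * α₃ - α₂ ^ 2)) / ((1 - α₁) * Δ) with hB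
  set B' := (α₃ * (1 - α₁) + q * (α₃ * α₁ - α₂ ^ 2)) / ((1 - α₃) * Δ) with hB'
  have key : (exchangeableCov q r α₁ α₂ α₃)⁻¹ = Matrix.fromBlocks
      (Matrix.of fun i j => (if i = j then 1 / (1 - α₁) else 0) - B)
      (Matrix.of fun _ _ => -α₂ / Δ) (Matrix.of fun _ _ => -α₂ / Δ)
      (Matrix.of fun i j => (if i = j then 1 / (1 - α₃) else 0) - B') := by
    apply Matrix.inv_eq_right_inv
    have e1 (m : ℕ) (a b c : ℝ) (i j : Fin m) :
        ∑ k, (if i = k then 1 else a) * ((if k = j then b else 0) - c) =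
        (if i = j then (1 - a) * b else 0) + a * b - (1 - a) * c - m * (a * c) := by
      have : ∀ k, (if i = k then (1 : ℝ) else a) * ((if k = j then b else 0) - c) =
          (if i = k then (1 - a) * ((if k = j then b else 0) - c) else 0) +
          (if k = j then a * b else 0) - a * c := by
        intro k; split_ifs <;> ring
      simp_rw [this, Finset.sum_sub_distrib, Finset.sum_add_distrib]
      simp
      split_ifs <;> ring
    have e2 (m : ℕ) (a c : ℝ) (i : Fin m) :
        ∑ k, (if i = k then 1 else a) * c = (1 - a) * c + m * (a * c) := by
      have : ∀ k, (if i = k then (1 : ℝ) else a) * c =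
          (if i = k then (1 - a) * c else 0) + a * c := by
        intro k; split_ifs <;> ring
      simp_rw [this, Finset.sum_add_distrib]
      simp
    have e3 (m : ℕ) (a b c : ℝ) (j : Fin m) :
        ∑ k, a * ((if k = j then b else 0) - c) = a * b - m * (a * c) := by
      simp_rw [← Finset.mul_sum, Finset.sum_sub_distrib]
      simp
      ring
    rw [exchangeableCov, Matrix.fromBlocks_multiply, ← Matrix.fromBlocks_one]
    congr 1 <;> ext i j <;> simp only [Matrix.add_apply, Matrix.mul_apply, of_apply, e1, e2, e3,
      Finset.sum_const, Finset.card_univ, Fintype.card_fin, nsmul_eq_mul, Matrix.one_apply,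
      Matrix.zero_apply]
    · have : α₁ * (1 / (1 - α₁)) - (1 - α₁) * B - q * (α₁ * B) + r * (α₂ * (-α₂ / Δ)) = 0 := by
        rw [hB]
        field_simp
        rw [hΔdef]
        ring
      split_ifs
      · rw [mul_one_div_cancel h₁']; linarith
      · linarith
    · rw [hB']
      field_simp
      rw [hΔdef]
      ring
    · rw [hB]
      field_simp
      rw [hΔdef]
      ring
    · have : α₃ * (1 / (1 - α₃)) - (1 - α₃) * B' - r * (α₃ * B') + q * (α₂ * (-α₂ / Δ)) = 0 := by
        rw [hB']
        field_simp
        rw [hΔdef]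
        ring
      split_ifs
      · rw [mul_one_div_cancel h₃']; linarith
      · linarith
  rw [key]
  simp

lemma exchangeable_det_pos (h₁ : α₁ < 1) (h₃ : α₃ < 1) (hn₁ : 0 ≤ α₁) (hn₃ : 0 ≤ α₃)
    (h₂ : α₂ ^ 2 ≤ α₁ * α₃) :
    0 < (1 - α₁ + q * α₁) * (1 - α₃ + r * α₃) - q * r * α₂ ^ 2 := by
  have e : (1 - α₁ + q * α₁) * (1 - α₃ + r * α₃) - q * r * α₂ ^ 2 =
      (1 - α₁) * (1 - α₃) + (1 - α₁) * (r * α₃) + q * α₁ * (1 - α₃) +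
        q * r * (α₁ * α₃ - α₂ ^ 2) := by ring
  rw [e]
  have a1 : 0 < 1 - α₁ := by linarith
  have a3 : 0 < 1 - α₃ := by linarith
  have a2 : 0 ≤ α₁ * α₃ - α₂ ^ 2 := by linarith
  positivity

/-- The correction to `1/(1 - α₁)` is `N / ((1 - α₁) Δ)` with `N ≥ 0` and `q N ≤ Δ`, so it costs at
most a relative `1/q`, uniformly in `r`. -/
lemma exchangeablePrecDiag_bounds (hq : 0 < q) (h₁ : α₁ < 1) (h₃ : α₃ < 1) (hn₁ : 0 ≤ α₁)
    (hn₃ : 0 ≤ α₃) (h₂ : α₂ ^ 2 ≤ α₁ * α₃) :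
    1 / (1 - α₁) - 1 / (1 - α₁) / q ≤ exchangeablePrecDiag q r α₁ α₂ α₃ ∧
      exchangeablePrecDiag q r α₁ α₂ α₃ ≤ 1 / (1 - α₁) := by
  have hΔ := exchangeable_det_pos (q := q) (r := r) h₁ h₃ hn₁ hn₃ h₂
  have a1 : 0 < 1 - α₁ := by linarith
  have a3 : 0 < 1 - α₃ := by linarith
  have a2 : 0 ≤ α₁ * α₃ - α₂ ^ 2 := by linarith
  have hq' : (0 : ℝ) < q := by exact_mod_cast hq
  unfold exchangeablePrecDiag
  set Δ := (1 - α₁ + q * α₁) * (1 - α₃ + r * α₃) - q * r * α₂ ^ 2 with hΔdef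
  set N := α₁ * (1 - α₃) + r * (α₁ * α₃ - α₂ ^ 2) with hN
  have hN0 : 0 ≤ N := by positivity
  have hqN : q * N ≤ Δ := by
    have : Δ - q * N = (1 - α₁) * (1 - α₃) + (1 - α₁) * (r * α₃) := by rw [hΔdef, hN]; ring
    have : 0 ≤ Δ - q * N := by rw [this]; positivity
    linarith
  have h0 : 0 ≤ N / ((1 - α₁) * Δ) := by positivity
  have h5 : N / ((1 - α₁) * Δ) ≤ 1 / (1 - α₁) / q := by
    rw [div_div, div_le_div_iff₀ (by positivity) (by positivity)]
    nlinarith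
  constructor <;> linarith
end

/-- The limiting `2 × 2` form with entries `α₁, α₂, α₃` is positive semidefinite, being a limit of
nonnegative values of the forms of `C`. -/
lemma exchangeable_parameters_of_posDef {q r : ℕ → ℕ} (hq : Tendsto q atTop atTop)
    (hr : Tendsto r atTop atTop) {α₁ α₂ α₃ : ℝ}
    (hC : ∀ n, (exchangeableCov (q n) (r n) α₁ α₂ α₃).PosDef) :
    0 ≤ α₁ ∧ 0 ≤ α₃ ∧ α₂ ^ 2 ≤ α₁ * α₃ := by
  have hlim (u w : ℝ) : 0 ≤ u ^ 2 * α₁ + 2 * u * w * α₂ + w ^ 2 * α₃ := by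
    have h1 : Tendsto (fun n => (1 - α₁) / (q n : ℝ)) atTop (𝓝 0) :=
      (tendsto_natCast_atTop_atTop.comp hq).const_div_atTop _
    have h2 : Tendsto (fun n => (1 - α₃) / (r n : ℝ)) atTop (𝓝 0) :=
      (tendsto_natCast_atTop_atTop.comp hr).const_div_atTop _
    have h3 : Tendsto (fun n => u ^ 2 * (α₁ + (1 - α₁) / q n) + 2 * u * w * α₂ +
        w ^ 2 * (α₃ + (1 - α₃) / r n)) atTop
        (𝓝 (u ^ 2 * (α₁ + 0) + 2 * u * w * α₂ + w ^ 2 * (α₃ + 0))) :=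
      (((h1.const_add α₁).const_mul _).add_const _).add ((h2.const_add α₃).const_mul _)
    rw [add_zero, add_zero] at h3
    refine ge_of_tendsto h3 ?_
    filter_upwards [hq.eventually_gt_atTop 0, hr.eventually_gt_atTop 0] with n hqn hrn
    rw [← exchangeableCov_quadForm hqn hrn]
    simpa using (hC n).posSemidef.dotProduct_mulVec_nonneg
      (Sum.elim (fun _ => u / (q n : ℝ)) (fun _ => w / (r n : ℝ)))
  have a1 : 0 ≤ α₁ := by simpa using hlim 1 0
  have a3 : 0 ≤ α₃ := by simpa using hlim 0 1
  refine ⟨a1, a3, ?_⟩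
  rcases a1.eq_or_lt with h | h
  · rw [← h, zero_mul]
    -- For `α₁ = 0` this vector gives the value `-4 α₂²`, which forces `α₂ = 0`.
    have e := hlim (-(α₃ + 1)) (2 * α₂)
    have e2 := hlim (-(α₃ + 1)) α₂
    rw [← h] at e e2
    nlinarith [sq_nonneg α₂]
  -- Here the form takes the value `α₁ (α₁ α₃ - α₂²)`.
  · have e := hlim (-α₂) α₁
    have : 0 ≤ α₁ * (α₁ * α₃ - α₂ ^ 2) := by nlinarith
    nlinarith [nonneg_of_mul_nonneg_right this h]

/-! ### SPAC as a rescaled regression coefficient -/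

section
variable {ι : Type*} [Fintype ι] [DecidableEq ι] {C : Matrix ι ι ℝ}

/-- The `j`-th column of `C C⁻¹ = 1` says that the regression coefficients of `X_j` on `X_{-j}` are
`-w / d_jj`, with `w` the off-diagonal part of the `j`-th column of `C⁻¹`. Since `Y = β_j X_j +
β_{-j} X_{-j} + ε`, those of `Y` are `β_{-j} - (β_j / d_jj) w`. -/
lemma partialCov_jointCov (hC : C.PosDef) (β : ι → ℝ) (σ : ℝ) (j : ι) :
    partialCov (jointCov C β σ) j none (some j) = β j / C⁻¹ j j ∧
    partialCov (jointCov C β σ) j (some j) (some j) = 1 / C⁻¹ j j ∧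
    partialCov (jointCov C β σ) j none none = σ ^ 2 + β j ^ 2 / C⁻¹ j j := by
  have hdpos : 0 < C⁻¹ j j := hC.inv.diag_pos
  have hd : C⁻¹ j j ≠ 0 := hdpos.ne'
  have hsymm (a b : ι) : C a b = C b a := by simpa using hC.isHermitian.apply b a
  have hdet : IsUnit C.det := (Matrix.isUnit_iff_isUnit_det C).1 hC.isUnit
  have hCD : C * C⁻¹ = 1 := Matrix.mul_nonsing_inv C hdet
  have hDC : C⁻¹ * C = 1 := Matrix.nonsing_inv_mul C hdet
  have hsymmD (a b : ι) : C⁻¹ a b = C⁻¹ b a := by simpa using hC.inv.isHermitian.apply b a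
  set R : Matrix {k : ι // k ≠ j} {k : ι // k ≠ j} ℝ := C.submatrix Subtype.val Subtype.val with hR
  have hRpos : R.PosDef := hC.submatrix Subtype.val_injective
  have hRdet : IsUnit R.det := (Matrix.isUnit_iff_isUnit_det R).1 hRpos.isUnit
  have hRinv (u : {k : ι // k ≠ j} → ℝ) : R⁻¹ *ᵥ (R *ᵥ u) = u := by
    rw [mulVec_mulVec, Matrix.nonsing_inv_mul _ hRdet, one_mulVec]
  set w : {k : ι // k ≠ j} → ℝ := fun k => C⁻¹ k.1 j with hw
  set c : {k : ι // k ≠ j} → ℝ := fun k => C k.1 j with hc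
  set m : {k : ι // k ≠ j} → ℝ := fun k => (C *ᵥ β) k.1 with hm
  have hRw : R *ᵥ w = -(C⁻¹ j j) • c := by
    ext k
    have h := congrFun (congrFun hCD k.1) j
    rw [Matrix.mul_apply, Fintype.sum_eq_add_sum_subtype_ne _ j, Matrix.one_apply_ne k.2] at h
    simp only [mulVec, dotProduct, hR, hw, hc, submatrix_apply, Pi.smul_apply, smul_eq_mul]
    linarith
  have hRc : R⁻¹ *ᵥ c = -(1 / C⁻¹ j j) • w := by
    have : c = R *ᵥ (-(1 / C⁻¹ j j) • w) := by
      rw [mulVec_smul, hRw, smul_smul]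
      field_simp
      simp
    rw [this, hRinv]
  have hRm : R⁻¹ *ᵥ m = (fun k => β k.1) + (-(β j / C⁻¹ j j)) • w := by
    have : m = R *ᵥ ((fun k => β k.1) + (-(β j / C⁻¹ j j)) • w) := by
      rw [mulVec_add, mulVec_smul, hRw, smul_smul]
      ext k
      simp only [hm, hR, hc, mulVec, dotProduct, Pi.add_apply, Pi.smul_apply, smul_eq_mul,
        submatrix_apply]
      rw [Fintype.sum_eq_add_sum_subtype_ne _ j]
      field_simp
      ring
    rw [this, hRinv]
  have hcw : c ⬝ᵥ w = 1 - C j j * C⁻¹ j j := by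
    have h := congrFun (congrFun hCD j) j
    rw [Matrix.mul_apply, Fintype.sum_eq_add_sum_subtype_ne _ j, Matrix.one_apply_eq] at h
    have e : c ⬝ᵥ w = ∑ k : {k : ι // k ≠ j}, C j k.1 * C⁻¹ k.1 j :=
      Finset.sum_congr rfl fun k _ => by simp only [hc, hw, hsymm j k.1]
    linarith
  have hmw : m ⬝ᵥ w = β j - (C *ᵥ β) j * C⁻¹ j j := by
    have h : (C⁻¹ *ᵥ (C *ᵥ β)) j = β j := by rw [mulVec_mulVec, hDC, one_mulVec]
    rw [mulVec, dotProduct, Fintype.sum_eq_add_sum_subtype_ne _ j] at h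
    have e : m ⬝ᵥ w = ∑ k : {k : ι // k ≠ j}, C⁻¹ j k.1 * (C *ᵥ β) k.1 :=
      Finset.sum_congr rfl fun k _ => by simp only [hm, hw, hsymmD j k.1]; ring
    linarith
  have hmb : m ⬝ᵥ (fun k => β k.1) = β ⬝ᵥ (C *ᵥ β) - β j * (C *ᵥ β) j := by
    have h : β ⬝ᵥ (C *ᵥ β) = ∑ k, β k * (C *ᵥ β) k := rfl
    rw [Fintype.sum_eq_add_sum_subtype_ne _ j] at h
    have e : m ⬝ᵥ (fun k => β k.1) = ∑ k : {k : ι // k ≠ j}, β k.1 * (C *ᵥ β) k.1 :=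
      Finset.sum_congr rfl fun k _ => by simp only [hm]; ring
    linarith
  have hsub : (jointCov C β σ).submatrix (fun k : {k : ι // k ≠ j} => some k.1)
      (fun k : {k : ι // k ≠ j} => some k.1) = R := rfl
  have hn1 : (fun k : {k : ι // k ≠ j} => jointCov C β σ none (some k.1)) = m := rfl
  have hn2 : (fun k : {k : ι // k ≠ j} => jointCov C β σ (some k.1) none) = m := rfl
  have hj2 : (fun k : {k : ι // k ≠ j} => jointCov C β σ (some k.1) (some j)) = c := rfl
  have hj1 : (fun k : {k : ι // k ≠ j} => jointCov C β σ (some j) (some k.1)) = c := by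
    ext k; exact hsymm j k.1
  have h00 : jointCov C β σ none none = β ⬝ᵥ (C *ᵥ β) + σ ^ 2 := rfl
  have h0j : jointCov C β σ none (some j) = (C *ᵥ β) j := rfl
  have hjj : jointCov C β σ (some j) (some j) = C j j := rfl
  refine ⟨?_, ?_, ?_⟩
  · rw [partialCov, hsub, hn1, hj2, hRc, h0j, dotProduct_smul, hmw, smul_eq_mul]
    field_simp
    ring
  · rw [partialCov, hsub, hj1, hj2, hRc, hjj, dotProduct_smul, hcw, smul_eq_mul]
    field_simp
    ring
  · rw [partialCov, hsub, hn1, hn2, hRm, h00, dotProduct_add, dotProduct_smul, hmw, hmb,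
      smul_eq_mul]
    field_simp
    ring

/-- The SPAC of the `j`-th covariate is its coefficient divided by `√d_jj`. -/
lemma spac_jointCov (hC : C.PosDef) (β : ι → ℝ) {σ : ℝ} (hσ : 0 < σ) (j : ι) :
    spac (jointCov C β σ) j = β j / √(C⁻¹ j j) := by
  have hdpos : 0 < C⁻¹ j j := hC.inv.diag_pos
  obtain ⟨h1, h2, h3⟩ := partialCov_jointCov hC β σ j
  have hpos : 0 < √(partialCov (jointCov C β σ) j none none) := by
    rw [h3]
    exact Real.sqrt_pos.2 (by positivity)
  have hs : 0 < √(C⁻¹ j j) := Real.sqrt_pos.2 hdpos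
  rw [spac, partialCorr, h1, h2, Real.sqrt_div zero_le_one, Real.sqrt_one]
  have e : C⁻¹ j j = √(C⁻¹ j j) * √(C⁻¹ j j) := (Real.mul_self_sqrt hdpos.le).symm
  field_simp
  linear_combination (-β j) * e

lemma sign_spac_jointCov (hC : C.PosDef) (β : ι → ℝ) {σ : ℝ} (hσ : 0 < σ) (j : ι) :
    SignType.sign (spac (jointCov C β σ) j) = SignType.sign (β j) := by
  have hdpos : 0 < √(C⁻¹ j j) := Real.sqrt_pos.2 hC.inv.diag_pos
  rw [spac_jointCov hC β hσ, div_eq_mul_inv, sign_mul, sign_pos (inv_pos.2 hdpos), mul_one]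
end

/-! ### The transformed irrepresentable vector under exchangeability -/

section
variable {q r : ℕ} {α₁ α₂ α₃ : ℝ}

lemma exchangeableCov_toBlocks₁₁_mulVec (v : Fin q → ℝ) (i : Fin q) :
    ((exchangeableCov q r α₁ α₂ α₃).toBlocks₁₁ *ᵥ v) i = (1 - α₁) * v i + α₁ * ∑ k, v k := by
  have : ∀ k, (if i = k then (1 : ℝ) else α₁) * v k =
      (if i = k then (1 - α₁) * v k else 0) + α₁ * v k := by
    intro k; split_ifs <;> ring
  simp only [exchangeableCov, toBlocks_fromBlocks₁₁, mulVec, dotProduct, of_apply, this,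
    Finset.sum_add_distrib, ← Finset.mul_sum]
  simp

/-- All column sums of `C₁₁` equal `1 - α₁ + qα₁`, so a constant matrix times `C₁₁` is again
constant; no explicit inverse of `C₁₁` is needed. -/
lemma exchangeableCov_toBlocks₂₁_mul_inv (hC : (exchangeableCov q r α₁ α₂ α₃).PosDef)
    (hs : 1 - α₁ + q * α₁ ≠ 0) :
    (exchangeableCov q r α₁ α₂ α₃).toBlocks₂₁ * (exchangeableCov q r α₁ α₂ α₃).toBlocks₁₁⁻¹ =
      Matrix.of fun _ _ => α₂ / (1 - α₁ + q * α₁) := by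
  have hpos : (exchangeableCov q r α₁ α₂ α₃).toBlocks₁₁.PosDef :=
    hC.submatrix Sum.inl_injective
  have hdet : IsUnit (exchangeableCov q r α₁ α₂ α₃).toBlocks₁₁.det :=
    (Matrix.isUnit_iff_isUnit_det _).1 hpos.isUnit
  have h : (exchangeableCov q r α₁ α₂ α₃).toBlocks₂₁ =
      (Matrix.of fun _ _ => α₂ / (1 - α₁ + q * α₁) : Matrix (Fin r) (Fin q) ℝ) *
        (exchangeableCov q r α₁ α₂ α₃).toBlocks₁₁ := by
    ext j i
    have e : ∀ k, (if k = i then (1 : ℝ) else α₁) = (if k = i then (1 - α₁) else 0) + α₁ := by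
      intro k; split_ifs <;> ring
    simp only [exchangeableCov, toBlocks_fromBlocks₁₁, toBlocks_fromBlocks₂₁, mul_apply, of_apply,
      ← Finset.mul_sum, e, Finset.sum_add_distrib]
    simp
    exact (div_mul_cancel₀ α₂ hs).symm
  rw [h, Matrix.mul_assoc, Matrix.mul_nonsing_inv _ hdet, Matrix.mul_one]

lemma abs_transformedIrrepVector (hC : (exchangeableCov q r α₁ α₂ α₃).PosDef)
    (hs : 0 < 1 - α₁ + q * α₁) {a b : ℝ} (ha : 0 < a)
    (hda : ∀ i, (exchangeableCov q r α₁ α₂ α₃)⁻¹ (Sum.inl i) (Sum.inl i) = a)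
    (hdb : ∀ j, (exchangeableCov q r α₁ α₂ α₃)⁻¹ (Sum.inr j) (Sum.inr j) = b)
    {γ β : Fin q ⊕ Fin r → ℝ}
    (hγ : ∀ j, SignType.sign (γ j) = SignType.sign (β j)) (j : Fin r) :
    |transformedIrrepVector (exchangeableCov q r α₁ α₂ α₃) γ j| =
      |α₂| / (1 - α₁ + q * α₁) * √a * signImbalance β / √b := by
  have hinv : (Matrix.diagonal (fun _ : Fin q => √(1 / a)))⁻¹ =
      Matrix.diagonal (fun _ : Fin q => √a) := by
    apply Matrix.inv_eq_right_inv
    rw [Matrix.diagonal_mul_diagonal, ← Matrix.diagonal_one]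
    congr 1
    ext i
    rw [← Real.sqrt_mul (by positivity), one_div_mul_cancel ha.ne', Real.sqrt_one]
  have e : transformedIrrepVector (exchangeableCov q r α₁ α₂ α₃) γ j =
      √(1 / b) * (α₂ / (1 - α₁ + q * α₁)) * √a *
        ((∑ i : Fin q, (SignType.sign (β (Sum.inl i)) : ℤ) : ℤ) : ℝ) := by
    unfold transformedIrrepVector
    simp_rw [hda, hdb]
    rw [hinv, Matrix.mul_assoc (Matrix.diagonal _), exchangeableCov_toBlocks₂₁_mul_inv hC hs.ne']
    simp only [mulVec, dotProduct, mul_diagonal, diagonal_mul, of_apply, ← Finset.mul_sum, hγ]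
    push_cast
    congr 1
  rw [e, abs_mul, abs_mul, abs_mul, abs_div, abs_of_pos hs, abs_of_nonneg (Real.sqrt_nonneg _),
    abs_of_nonneg (Real.sqrt_nonneg _), signImbalance, Nat.cast_natAbs, Real.sqrt_div zero_le_one,
    Real.sqrt_one, Int.cast_abs]
  ring
end

/-- The correlation condition bounds the irrepresentable vector away from `1`. -/
lemma eventually_exchangeable_irrep_le {q r m : ℕ → ℕ} (hq : Tendsto q atTop atTop)
    (hr : Tendsto r atTop atTop) (hm : Tendsto m atTop atTop) {α₁ α₂ α₃ : ℝ} (h₁ : α₁ < 1)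
    (h₃ : α₃ < 1) (hn₁ : 0 ≤ α₁) (hn₃ : 0 ≤ α₃) (h₂ : α₂ ^ 2 ≤ α₁ * α₃) {η : ℝ} (hη : 0 < η)
    (hcond : ((|α₂| : ℝ) : EReal) ≤
      (((1 - η) * √((1 - α₁) / (1 - α₃)) * α₁ : ℝ) : EReal) *
        liminf (fun n => (((q n : ℝ) / (m n : ℝ) : ℝ) : EReal)) atTop) :
    ∃ η' : ℝ, 0 < η' ∧ ∀ᶠ n in atTop,
      |α₂| / (1 - α₁ + q n * α₁) * √(exchangeablePrecDiag (q n) (r n) α₁ α₂ α₃) * m n ≤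
        (1 - η') * √(exchangeablePrecDiag (r n) (q n) α₃ α₂ α₁) := by
  have a1 : 0 < 1 - α₁ := by linarith
  have a3 : 0 < 1 - α₃ := by linarith
  -- This case is separate because `α₁` may then vanish; a nonzero `α₂` forces `α₁ > 0` through `α₂²
  -- ≤ α₁α₃`.
  by_cases hα₂ : α₂ = 0
  · refine ⟨1, one_pos, Eventually.of_forall fun n => ?_⟩
    simp [hα₂]
  have hα₂' : 0 < |α₂| := abs_pos.2 hα₂
  have hprod : 0 < α₁ * α₃ := lt_of_lt_of_le (by positivity) h₂
  have hα₁ : 0 < α₁ := lt_of_le_of_ne hn₁ (by rintro rfl; simp at hprod)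
  set L := liminf (fun n => (((q n : ℝ) / (m n : ℝ) : ℝ) : EReal)) atTop with hL
  have hL0 : 0 ≤ L := by
    refine le_liminf_of_le (by isBoundedDefault) (Eventually.of_forall fun n => ?_)
    exact_mod_cast (by positivity : (0 : ℝ) ≤ (q n : ℝ) / (m n : ℝ))
  set ρ := √((1 - α₁) / (1 - α₃)) with hρ
  have hρ0 : 0 < ρ := Real.sqrt_pos.2 (by positivity)
  -- For `η ≥ 1` the right side of the condition would be nonpositive, against `α₂ ≠ 0`.
  have hη1 : η < 1 := by
    by_contra hcon
    have h5 : (((1 - η) * ρ * α₁ : ℝ) : EReal) ≤ 0 := by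
      have : (1 - η) * ρ * α₁ ≤ 0 := by
        rw [mul_assoc]
        exact mul_nonpos_of_nonpos_of_nonneg (by linarith) (by positivity)
      exact_mod_cast this
    have h6 := mul_le_mul_of_nonneg_right h5 hL0
    rw [zero_mul] at h6
    have h7 := hcond.trans h6
    have : |α₂| ≤ 0 := by exact_mod_cast h7
    linarith
  set c := (1 - η) * ρ * α₁ with hc
  have e1 : 0 < 1 - η := by linarith
  have e2 : 0 < 1 - η / 2 := by linarith
  have e4 : 0 < 1 - η / 4 := by linarith
  have hc0 : 0 < c := by positivity
  -- A real number strictly below `|α₂| / c ≤ L`, so `q/m > θ` eventually, also when `L = ∞`. It is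
  -- chosen so that `|α₂| / (θ α₁) = (1 - η/2) ρ`.
  set θ := |α₂| / c * ((1 - η) / (1 - η / 2)) with hθ
  have hθ0 : 0 < θ := by positivity
  have hθL : (θ : EReal) < L := by
    by_contra hcon
    have h5 := mul_le_mul_of_nonneg_left (not_lt.1 hcon)
      (show (0 : EReal) ≤ (c : EReal) by exact_mod_cast hc0.le)
    have h6 : |α₂| ≤ c * θ := by exact_mod_cast hcond.trans h5
    have h7 : c * θ = |α₂| * ((1 - η) / (1 - η / 2)) := by rw [hθ]; field_simp
    have h8 : (1 - η) / (1 - η / 2) < 1 := (div_lt_one e2).2 (by linarith)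
    rw [h7] at h6
    nlinarith
  -- Passing from the liminf to `θ` reduces the slack to `η/2`; replacing `b` by its limit `1/(1 -
  -- α₃)` reduces it to `η/4`.
  refine ⟨η / 4, by positivity, ?_⟩
  have hlim : Tendsto (fun n => √(1 / (1 - α₃) - 1 / (1 - α₃) / r n)) atTop
      (𝓝 √(1 / (1 - α₃) - 0)) := by
    apply Tendsto.sqrt
    exact ((tendsto_natCast_atTop_atTop.comp hr).const_div_atTop _).const_sub _
  rw [sub_zero] at hlim
  have hb0 : 0 < √(1 / (1 - α₃)) := Real.sqrt_pos.2 (by positivity)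
  have hlt : (1 - η / 2) / (1 - η / 4) * √(1 / (1 - α₃)) < √(1 / (1 - α₃)) := by
    have : (1 - η / 2) / (1 - η / 4) < 1 := (div_lt_one e4).2 (by linarith)
    nlinarith
  filter_upwards [eventually_lt_of_lt_liminf hθL, hm.eventually_gt_atTop 0,
    hq.eventually_gt_atTop 0, hr.eventually_gt_atTop 0, hlim.eventually_const_lt hlt]
    with n h1 h2m h3q h3r h4
  have hmpos : (0 : ℝ) < m n := by exact_mod_cast h2m
  have hqpos : (0 : ℝ) < q n := by exact_mod_cast h3q
  have h1' : θ < q n / m n := by exact_mod_cast h1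
  rw [lt_div_iff₀ hmpos] at h1'
  have hX : |α₂| / (1 - α₁ + q n * α₁) * m n ≤ (1 - η / 2) * ρ := by
    have : (1 - η / 2) * ρ = |α₂| / (θ * α₁) := by
      rw [hθ, hc]
      field_simp
    rw [this, div_mul_eq_mul_div, div_le_div_iff₀ (by positivity) (by positivity)]
    have : m n * (θ * α₁) ≤ 1 - α₁ + q n * α₁ := by nlinarith
    nlinarith
  have hA := (exchangeablePrecDiag_bounds (q := q n) (r := r n) h3q h₁ h₃ hn₁ hn₃ h₂).2
  have hB := (exchangeablePrecDiag_bounds (q := r n) (r := q n) h3r h₃ h₁ hn₃ hn₁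
    (h₂.trans_eq (mul_comm α₁ α₃))).1
  calc |α₂| / (1 - α₁ + q n * α₁) * √(exchangeablePrecDiag (q n) (r n) α₁ α₂ α₃) * m n
      = (|α₂| / (1 - α₁ + q n * α₁) * m n) * √(exchangeablePrecDiag (q n) (r n) α₁ α₂ α₃) := by
        ring
    _ ≤ ((1 - η / 2) * ρ) * √(1 / (1 - α₁)) := by gcongr
    _ = (1 - η / 2) * √(1 / (1 - α₃)) := by
        rw [mul_assoc, hρ, ← Real.sqrt_mul (by positivity)]
        congr 2
        field_simp
    _ = (1 - η / 4) * ((1 - η / 2) / (1 - η / 4) * √(1 / (1 - α₃))) := by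
        rw [← mul_assoc, mul_div_assoc', mul_div_cancel_left₀ _ e4.ne']
    _ ≤ (1 - η / 4) * √(exchangeablePrecDiag (r n) (q n) α₃ α₂ α₁) := by
        gcongr
        exact h4.le.trans (Real.sqrt_le_sqrt hB)

/-! ### Convexity: KKT conditions and uniqueness -/

section
variable {ι : Type*} [Fintype ι] {n : ℕ}

/-- The squared loss has an exact second-order expansion at `g₀`. Its linear part is paired with the
penalty coordinatewise, so that KKT makes every summand nonnegative. -/
lemma spacLassoLoss_sub (x : Fin n → EuclideanSpace ℝ ι) (y : Fin n → ℝ) (d : ι → ℝ) (lam : ℝ)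
    (g g₀ : ι → ℝ) :
    spacLassoLoss x y d lam g - spacLassoLoss x y d lam g₀ =
      1 / 2 * ∑ i, (∑ j, x i j * √(d j) * (g j - g₀ j)) ^ 2 +
      ∑ j, (lam * d j * (|g j| - |g₀ j|) -
        √(d j) * (∑ i, x i j * (y i - ∑ k, x i k * √(d k) * g₀ k)) * (g j - g₀ j)) := by
  set ρ : Fin n → ℝ := fun i => y i - ∑ k, x i k * √(d k) * g₀ k with hρ
  set z : Fin n → ℝ := fun i => ∑ j, x i j * √(d j) * (g j - g₀ j) with hz
  have e1 : ∀ i, y i - ∑ j, x i j * √(d j) * g j = ρ i - z i := by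
    intro i
    simp only [hρ, hz, mul_sub, Finset.sum_sub_distrib]
    ring
  have e2 : ∑ j, √(d j) * (∑ i, x i j * ρ i) * (g j - g₀ j) = ∑ i, ρ i * z i := by
    simp only [hz, Finset.mul_sum, Finset.sum_mul]
    rw [Finset.sum_comm]
    exact Finset.sum_congr rfl fun i _ => Finset.sum_congr rfl fun j _ => by ring
  rw [Finset.sum_sub_distrib, e2]
  unfold spacLassoLoss
  simp only [e1]
  have e3 : ∀ i, (ρ i - z i) ^ 2 = ρ i ^ 2 - 2 * (ρ i * z i) + z i ^ 2 := fun i => by ring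
  have e4 : ∀ j, lam * d j * (|g j| - |g₀ j|) = lam * (d j * |g j|) - lam * (d j * |g₀ j|) :=
    fun j => by ring
  simp only [e3, e4, Finset.sum_add_distrib, Finset.sum_sub_distrib, ← Finset.mul_sum]
  change 1 / 2 * (∑ i, ρ i ^ 2 - 2 * ∑ i, ρ i * z i + ∑ i, z i ^ 2) + _ -
    (1 / 2 * ∑ i, ρ i ^ 2 + _) = _
  ring

/-- A vector satisfying the strict Karush-Kuhn-Tucker conditions, with a design that is injective
on its support, is the unique minimizer of the SPAC-Lasso objective. -/
lemma isSpacLasso_unique_of_kkt (x : Fin n → EuclideanSpace ℝ ι) (y : Fin n → ℝ) (d : ι → ℝ)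
    (lam : ℝ) (hlam : 0 ≤ lam) (hd : ∀ j, 0 < d j) (g₀ : ι → ℝ) (S : Set ι)
    (hS : ∀ j ∈ S, √(d j) * (∑ i, x i j * (y i - ∑ k, x i k * √(d k) * g₀ k)) =
      lam * d j * SignType.sign (g₀ j))
    (hSc : ∀ j ∉ S, g₀ j = 0 ∧
      |√(d j) * (∑ i, x i j * (y i - ∑ k, x i k * √(d k) * g₀ k))| < lam * d j)
    (hinj : ∀ v : ι → ℝ, (∀ j ∉ S, v j = 0) → (∀ i, ∑ j, x i j * v j = 0) → v = 0) :
    IsSpacLasso x y d lam g₀ ∧ ∀ g, IsSpacLasso x y d lam g → g = g₀ := by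
  have hterm : ∀ (g : ι → ℝ) j, 0 ≤ lam * d j * (|g j| - |g₀ j|) -
      √(d j) * (∑ i, x i j * (y i - ∑ k, x i k * √(d k) * g₀ k)) * (g j - g₀ j) ∧
      (j ∉ S → lam * d j * (|g j| - |g₀ j|) -
      √(d j) * (∑ i, x i j * (y i - ∑ k, x i k * √(d k) * g₀ k)) * (g j - g₀ j) ≤ 0 →
        g j = 0) := by
    intro g j
    by_cases hj : j ∈ S
    · refine ⟨?_, fun h => absurd hj h⟩
      rw [hS j hj]
      have e1 : (SignType.sign (g₀ j) : ℝ) * g₀ j = |g₀ j| := by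
        rw [sign_mul_self]
      have e2 : (SignType.sign (g₀ j) : ℝ) * g j ≤ |g j| := by
        refine (le_abs_self _).trans ?_
        rw [abs_mul]
        refine mul_le_of_le_one_left (abs_nonneg _) ?_
        cases SignType.sign (g₀ j) <;> simp
      have e3 : 0 ≤ lam * d j := mul_nonneg hlam (hd j).le
      nlinarith
    · obtain ⟨h0, h1⟩ := hSc j hj
      rw [h0, abs_zero, sub_zero, sub_zero]
      set G := √(d j) * (∑ i, x i j * (y i - ∑ k, x i k * √(d k) * g₀ k))
      have e : G * g j ≤ |G| * |g j| := by rw [← abs_mul]; exact le_abs_self _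
      have h3 := abs_nonneg (g j)
      refine ⟨by nlinarith, fun _ h => ?_⟩
      by_contra hne
      have := abs_pos.2 hne
      nlinarith
  constructor
  · intro g
    have h := spacLassoLoss_sub x y d lam g g₀
    have h1 := Finset.sum_nonneg fun j (_ : j ∈ Finset.univ) => (hterm g j).1
    have h2 : 0 ≤ ∑ i, (∑ j, x i j * √(d j) * (g j - g₀ j)) ^ 2 :=
      Finset.sum_nonneg fun i _ => sq_nonneg _
    linarith
  · intro g hg
    have h := spacLassoLoss_sub x y d lam g g₀
    have hle := hg g₀
    have h1 := Finset.sum_nonneg fun j (_ : j ∈ Finset.univ) => (hterm g j).1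
    have h2 : 0 ≤ ∑ i, (∑ j, x i j * √(d j) * (g j - g₀ j)) ^ 2 :=
      Finset.sum_nonneg fun i _ => sq_nonneg _
    have h3 : ∑ i, (∑ j, x i j * √(d j) * (g j - g₀ j)) ^ 2 = 0 := by linarith
    have h4 := (Finset.sum_eq_zero_iff_of_nonneg fun j _ => (hterm g j).1).1
      (show _ = (0 : ℝ) by linarith)
    have h5 := (Finset.sum_eq_zero_iff_of_nonneg fun i _ => sq_nonneg _).1 h3
    -- Equality of the losses kills the quadratic term and each penalty term: the difference is
    -- supported in `S` and annihilated by the design.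
    have h6 : (fun j => √(d j) * (g j - g₀ j)) = 0 := by
      apply hinj
      · intro j hj
        rw [(hSc j hj).1, (hterm g j).2 hj (h4 j (Finset.mem_univ j)).le]
        simp
      · intro i
        have := pow_eq_zero_iff (two_ne_zero) |>.1 (h5 i (Finset.mem_univ i))
        rw [← this]
        exact Finset.sum_congr rfl fun j _ => by ring
    ext j
    have h7 := congrFun h6 j
    have h8 := (Real.sqrt_pos.2 (hd j)).ne'
    simp only [Pi.zero_apply, mul_eq_zero, h8, false_or] at h7
    linarith
end

/-! ### Coercive matrices and Euclidean norm estimates -/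

section
variable {ι : Type*} [Fintype ι]

lemma abs_dotProduct_le_sqrt_mul_sqrt (v w : ι → ℝ) : |v ⬝ᵥ w| ≤ √(v ⬝ᵥ v) * √(w ⬝ᵥ w) := by
  have h := Finset.sum_mul_sq_le_sq_mul_sq Finset.univ v w
  have hv : 0 ≤ v ⬝ᵥ v := Finset.sum_nonneg fun i _ => mul_self_nonneg _
  rw [← Real.sqrt_mul hv]
  apply Real.abs_le_sqrt
  simpa [dotProduct, sq] using h

lemma sqrt_dotProduct_self_le {w : ι → ℝ} {c : ℝ} (hc : 0 ≤ c) (hw : ∀ i, |w i| ≤ c) :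
    √(w ⬝ᵥ w) ≤ √(Fintype.card ι) * c := by
  have : w ⬝ᵥ w ≤ Fintype.card ι * c ^ 2 := by
    calc w ⬝ᵥ w ≤ ∑ _i : ι, c ^ 2 := Finset.sum_le_sum fun i _ => by
          rw [← sq, ← sq_abs]
          exact pow_le_pow_left₀ (abs_nonneg _) (hw i) 2
      _ = _ := by simp
  calc _ ≤ √(Fintype.card ι * c ^ 2) := Real.sqrt_le_sqrt this
    _ = _ := by rw [Real.sqrt_mul (by positivity), Real.sqrt_sq hc]

lemma abs_apply_le_sqrt_dotProduct_self (w : ι → ℝ) (i : ι) : |w i| ≤ √(w ⬝ᵥ w) := by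
  apply Real.abs_le_sqrt
  rw [sq]
  exact Finset.single_le_sum (f := fun j => w j * w j) (fun j _ => mul_self_nonneg _)
    (Finset.mem_univ i)

lemma abs_sum_le_card_mul {w : ι → ℝ} {c : ℝ} (hw : ∀ i, |w i| ≤ c) :
    |∑ i, w i| ≤ Fintype.card ι * c := by
  calc _ ≤ ∑ i, |w i| := Finset.abs_sum_le_sum_abs _ _
    _ ≤ ∑ _i : ι, c := Finset.sum_le_sum fun i _ => hw i
    _ = _ := by simp

/-- Cauchy–Schwarz applied to `v ⬝ᵥ A v`; it plays the role of `‖A⁻¹‖ ≤ 1/κ`. -/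
lemma mul_sqrt_le_sqrt_of_coercive {A : Matrix ι ι ℝ} {κ : ℝ}
    (hA : ∀ v, κ * (v ⬝ᵥ v) ≤ v ⬝ᵥ (A *ᵥ v)) (v : ι → ℝ) :
    κ * √(v ⬝ᵥ v) ≤ √((A *ᵥ v) ⬝ᵥ (A *ᵥ v)) := by
  have h1 := (hA v).trans ((le_abs_self _).trans (abs_dotProduct_le_sqrt_mul_sqrt v (A *ᵥ v)))
  have hv : 0 ≤ v ⬝ᵥ v := Finset.sum_nonneg fun i _ => mul_self_nonneg _
  rcases (Real.sqrt_nonneg (v ⬝ᵥ v)).eq_or_lt with h0 | h0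
  · rw [← h0, mul_zero]; exact Real.sqrt_nonneg _
  · have e := Real.mul_self_sqrt hv
    refine le_of_mul_le_mul_left ?_ h0
    calc _ = κ * (√(v ⬝ᵥ v) * √(v ⬝ᵥ v)) := by ring
      _ ≤ _ := by rw [e]; exact h1

lemma exists_mulVec_eq_of_coercive [DecidableEq ι] {A : Matrix ι ι ℝ} {κ : ℝ} (hκ : 0 < κ)
    (hA : ∀ v, κ * (v ⬝ᵥ v) ≤ v ⬝ᵥ (A *ᵥ v)) (u : ι → ℝ) : ∃ v, A *ᵥ v = u := by
  have hinj : Function.Injective A.mulVec := by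
    intro v w hvw
    have h0 : A *ᵥ (v - w) = 0 := by rw [mulVec_sub]; exact sub_eq_zero.2 hvw
    have h1 := hA (v - w)
    rw [h0, dotProduct_zero] at h1
    have h2 : 0 ≤ (v - w) ⬝ᵥ (v - w) := Finset.sum_nonneg fun i _ => mul_self_nonneg _
    have h3 : (v - w) ⬝ᵥ (v - w) = 0 := by nlinarith
    exact sub_eq_zero.1 (dotProduct_self_eq_zero.1 h3)
  exact Matrix.mulVec_surjective_iff_isUnit.2 (Matrix.mulVec_injective_iff_isUnit.1 hinj) u

/-- A matrix close to an equicorrelation matrix is coercive. -/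
lemma coercive_of_abs_sub_equicorrelation_le [DecidableEq ι] {A : Matrix ι ι ℝ} {α t κ : ℝ}
    (hα : 0 ≤ α) (ht : 0 ≤ t)
    (hA : ∀ i j, |A i j - if i = j then 1 else α| ≤ t) (hκ : κ + Fintype.card ι * t ≤ 1 - α)
    (v : ι → ℝ) : κ * (v ⬝ᵥ v) ≤ v ⬝ᵥ (A *ᵥ v) := by
  have hv : 0 ≤ v ⬝ᵥ v := Finset.sum_nonneg fun i _ => mul_self_nonneg _
  -- The equicorrelation part is `(1 - α)‖v‖² + α (∑ v)²`, and the perturbation is at most `t (∑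
  -- |v|)² ≤ t · card · ‖v‖²`.
  have e1 : v ⬝ᵥ (A *ᵥ v) = (1 - α) * (v ⬝ᵥ v) + α * (∑ i, v i) ^ 2 +
      ∑ i, ∑ j, v i * ((A i j - if i = j then 1 else α) * v j) := by
    have h (i j : ι) : v i * (A i j * v j) = (if i = j then (1 - α) * (v i * v j) else 0) +
        α * (v i * v j) + v i * ((A i j - if i = j then 1 else α) * v j) := by
      split_ifs <;> ring
    simp only [dotProduct, mulVec, Finset.mul_sum, h, Finset.sum_add_distrib]
    rw [sq, Finset.sum_mul_sum]
    simp [Finset.mul_sum]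
  have e2 : |∑ i, ∑ j, v i * ((A i j - if i = j then 1 else α) * v j)| ≤
      t * (Fintype.card ι * (v ⬝ᵥ v)) := by
    calc _ ≤ ∑ i, |∑ j, v i * ((A i j - if i = j then 1 else α) * v j)| :=
          Finset.abs_sum_le_sum_abs _ _
      _ ≤ ∑ i, ∑ j, |v i * ((A i j - if i = j then 1 else α) * v j)| :=
          Finset.sum_le_sum fun i _ => Finset.abs_sum_le_sum_abs _ _
      _ ≤ ∑ i, ∑ j, t * (|v i| * |v j|) :=
          Finset.sum_le_sum fun i _ => Finset.sum_le_sum fun j _ => by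
            rw [abs_mul, abs_mul]
            have := mul_le_mul_of_nonneg_right (hA i j)
              (mul_nonneg (abs_nonneg (v i)) (abs_nonneg (v j)))
            linarith
      _ = t * (∑ i, |v i|) ^ 2 := by
          rw [sq, Finset.sum_mul_sum]
          simp only [Finset.mul_sum]
      _ ≤ _ := by
          have h := sq_sum_le_card_mul_sum_sq (s := Finset.univ) (f := fun i => |v i|)
          simp only [sq_abs, Finset.card_univ] at h
          have h2 : v ⬝ᵥ v = ∑ i, v i ^ 2 := by simp [dotProduct, sq]
          rw [h2]
          gcongr
  have e3 := neg_abs_le (∑ i, ∑ j, v i * ((A i j - if i = j then 1 else α) * v j))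
  have e4 : 0 ≤ α * (∑ i, v i) ^ 2 := by positivity
  have e5 := mul_le_mul_of_nonneg_right hκ hv
  rw [e1]
  nlinarith
end

lemma sign_add_eq_of_abs_lt {a b : ℝ} (h : |b| < |a|) :
    SignType.sign (a + b) = SignType.sign a := by
  obtain ⟨h1, h2⟩ := abs_lt.1 h
  rcases lt_trichotomy a 0 with ha | ha | ha
  · rw [abs_of_neg ha] at h1 h2
    rw [sign_neg ha, sign_neg (by linarith)]
  · rw [ha, abs_zero] at h
    exact absurd h (abs_nonneg b).not_gt
  · rw [abs_of_pos ha] at h1 h2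
    rw [sign_pos ha, sign_pos (by linarith)]

/-! ### The primal-dual witness -/

section
variable {q r n : ℕ} {α₁ α₂ α₃ : ℝ}

/-- Primal-dual witness: when the sample covariances and the estimated precisions are close enough
to their targets, SPAC-Lasso recovers the signs. -/
lemma spacLasso_sign_of_deviation_le (hn : 0 < n)
    (x : Fin n → EuclideanSpace ℝ (Fin q ⊕ Fin r)) (e : Fin n → ℝ) (β d : Fin q ⊕ Fin r → ℝ)
    (hβ₂ : ∀ j, β (Sum.inr j) = 0) {t t' κ B K τ ρ a b : ℝ} (hα₁ : 0 ≤ α₁)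
    (hs : 0 < 1 - α₁ + q * α₁) (ht : 0 ≤ t) (ht' : 0 ≤ t') (hK : 0 ≤ K) (hτ : 0 < τ) (hκ : 0 < κ)
    (hκt : κ + q * t ≤ 1 - α₁) (hB : q * (|α₂| / (1 - α₁ + q * α₁)) ≤ B)
    (hG : ∀ k l, |∑ i, x i k * x i l - n * exchangeableCov q r α₁ α₂ α₃ k l| ≤ n * t)
    (hu : ∀ k, |∑ i, x i k * e i| ≤ n * t) (hd : ∀ j, 0 < d j) (hdK : ∀ j, √(d j) ≤ K)
    (hda : ∀ i, |√(d (Sum.inl i)) - √a| ≤ t') (hdb : ∀ j, |√(d (Sum.inr j)) - √b| ≤ t')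
    (hρ : |α₂| / (1 - α₁ + q * α₁) * √a * signImbalance β ≤ ρ)
    (hβ : ∀ i, √q * (t + τ * K) < κ * |β (Sum.inl i)|)
    (hdual : t + B * t + τ * (ρ + B * t') + q * t * (1 + B) * (t + τ * K) / κ < τ * (√b - t')) :
    (∃ g, IsSpacLasso x (response x β e) d (n * τ) g) ∧
      ∀ g, IsSpacLasso x (response x β e) d (n * τ) g →
        ∀ j, SignType.sign (g j) = SignType.sign (β j) := by
  have hn' : (0 : ℝ) < n := by exact_mod_cast hn
  set s₀ := 1 - α₁ + q * α₁ with hs₀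
  set G : Matrix (Fin q ⊕ Fin r) (Fin q ⊕ Fin r) ℝ :=
    Matrix.of fun k l => (∑ i, x i k * x i l) / n with hGdef
  set u : Fin q ⊕ Fin r → ℝ := fun k => (∑ i, x i k * e i) / n with hudef
  have hG' : ∀ k l, |G k l - exchangeableCov q r α₁ α₂ α₃ k l| ≤ t := by
    intro k l
    have h : G k l - exchangeableCov q r α₁ α₂ α₃ k l =
        (∑ i, x i k * x i l - n * exchangeableCov q r α₁ α₂ α₃ k l) / n := by
      simp only [hGdef, of_apply]; field_simp
    rw [h, abs_div, abs_of_pos hn', div_le_iff₀ hn']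
    linarith [hG k l]
  have hu' : ∀ k, |u k| ≤ t := by
    intro k
    rw [hudef, abs_div, abs_of_pos hn', div_le_iff₀ hn']
    linarith [hu k]
  set A : Matrix (Fin q) (Fin q) ℝ := Matrix.of fun i j => G (Sum.inl i) (Sum.inl j) with hAdef
  have hAcoer : ∀ v, κ * (v ⬝ᵥ v) ≤ v ⬝ᵥ (A *ᵥ v) :=
    coercive_of_abs_sub_equicorrelation_le hα₁ ht
      (fun i j => hG' (Sum.inl i) (Sum.inl j)) (by simpa using hκt)
  have hAsymm : Aᵀ = A := by
    ext i j
    simp only [hAdef, hGdef, transpose_apply, of_apply, mul_comm]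
  set s : Fin q → ℝ := fun i => (SignType.sign (β (Sum.inl i)) : ℝ) with hsdef
  have hs1 : ∀ i, |s i| ≤ 1 := by
    intro i
    simp only [hsdef]
    cases SignType.sign (β (Sum.inl i)) <;> simp
  -- Right side of the stationarity equations on the relevant block, in the `β` scale: `Δ` below
  -- solves `A Δ = z` and is the estimation error of the restricted problem.
  set z : Fin q → ℝ := fun i => u (Sum.inl i) - τ * (√(d (Sum.inl i)) * s i) with hzdef
  obtain ⟨Δ, hΔ⟩ := exists_mulVec_eq_of_coercive hκ hAcoer z
  have hz : ∀ i, |z i| ≤ t + τ * K := by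
    intro i
    have h1 := abs_sub (u (Sum.inl i)) (τ * (√(d (Sum.inl i)) * s i))
    have h2 : |τ * (√(d (Sum.inl i)) * s i)| ≤ τ * K := by
      rw [abs_mul, abs_mul, abs_of_pos hτ, abs_of_nonneg (Real.sqrt_nonneg _)]
      have : √(d (Sum.inl i)) * |s i| ≤ K * 1 :=
        mul_le_mul (hdK _) (hs1 i) (abs_nonneg _) hK
      nlinarith
    linarith [hu' (Sum.inl i)]
  have hzn : √(z ⬝ᵥ z) ≤ √q * (t + τ * K) := by
    simpa using sqrt_dotProduct_self_le (by positivity) hz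
  have hΔβ : ∀ i, |Δ i| < |β (Sum.inl i)| := by
    intro i
    have h1 := mul_sqrt_le_sqrt_of_coercive hAcoer Δ
    rw [hΔ] at h1
    have h2 := mul_le_mul_of_nonneg_left (abs_apply_le_sqrt_dotProduct_self Δ i) hκ.le
    exact lt_of_mul_lt_mul_left (h2.trans_lt (h1.trans_lt (hzn.trans_lt (hβ i)))) hκ.le
  -- The population regression of an irrelevant covariate on the relevant ones has all coefficients
  -- equal to `b₀`.
  set b₀ := α₂ / s₀ with hb₀
  have hb₀abs : |b₀| = |α₂| / s₀ := by rw [hb₀, abs_div, abs_of_pos hs]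
  have hB0 : 0 ≤ B := le_trans (by positivity) hB
  -- The main term `b₀ √a ∑ s` is the irrepresentable vector times `√b`; the rest comes from the
  -- noise and from the error in `d̂`.
  have hsumz : |b₀ * ∑ i, z i| ≤ B * t + τ * (ρ + B * t') := by
    have e1 : b₀ * ∑ i, z i = b₀ * ∑ i, u (Sum.inl i) - τ * (b₀ * √a * ∑ i, s i +
        b₀ * ∑ i, (√(d (Sum.inl i)) - √a) * s i) := by
      have : ∀ i, z i = u (Sum.inl i) - τ * (√a * s i) -
          τ * ((√(d (Sum.inl i)) - √a) * s i) := fun i => by simp only [hzdef]; ring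
      simp only [this, Finset.sum_sub_distrib, ← Finset.mul_sum]
      ring
    have e2 : |b₀ * ∑ i, u (Sum.inl i)| ≤ B * t := by
      rw [abs_mul, hb₀abs]
      have h1 := abs_sum_le_card_mul (fun i : Fin q => hu' (Sum.inl i))
      rw [Fintype.card_fin] at h1
      calc _ ≤ |α₂| / s₀ * (q * t) := by gcongr
        _ = (q * (|α₂| / s₀)) * t := by ring
        _ ≤ _ := by gcongr
    have e3 : |b₀ * √a * ∑ i, s i| ≤ ρ := by
      have : |∑ i, s i| = signImbalance β := by
        rw [signImbalance, Nat.cast_natAbs, Int.cast_abs]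
        push_cast
        rfl
      rw [abs_mul, abs_mul, this, hb₀abs, abs_of_nonneg (Real.sqrt_nonneg a)]
      exact hρ
    have e4 : |b₀ * ∑ i, (√(d (Sum.inl i)) - √a) * s i| ≤ B * t' := by
      rw [abs_mul, hb₀abs]
      have h1 : ∀ i : Fin q, |(√(d (Sum.inl i)) - √a) * s i| ≤ t' := fun i => by
        rw [abs_mul]
        exact (mul_le_of_le_one_right (abs_nonneg _) (hs1 i)).trans (hda i)
      have h2 := abs_sum_le_card_mul h1
      rw [Fintype.card_fin] at h2
      calc _ ≤ |α₂| / s₀ * (q * t') := by gcongr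
        _ = (q * (|α₂| / s₀)) * t' := by ring
        _ ≤ _ := by gcongr
    rw [e1]
    refine (abs_sub _ _).trans (add_le_add e2 ?_)
    rw [abs_mul, abs_of_pos hτ]
    gcongr
    exact (abs_add_le _ _).trans (add_le_add e3 e4)
  have hdualj : ∀ j : Fin r, |u (Sum.inr j) - ∑ k, G (Sum.inr j) (Sum.inl k) * Δ k| <
      τ * √(d (Sum.inr j)) := by
    intro j
    set bj : Fin q → ℝ := fun k => G (Sum.inr j) (Sum.inl k) with hbj
    -- Here `c` is the sample regression vector minus `b₀` times the all-ones vector. The entries of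
    -- `A c` are only covariance errors, so `c` has norm at most `√q t (1 + B) / κ`.
    obtain ⟨c, hc⟩ := exists_mulVec_eq_of_coercive hκ hAcoer (bj - b₀ • (A *ᵥ fun _ => 1))
    have hbjA : bj = A *ᵥ (c + b₀ • fun _ => 1) := by
      rw [mulVec_add, mulVec_smul, hc, sub_add_cancel]
    have h1 : ∑ k, G (Sum.inr j) (Sum.inl k) * Δ k = c ⬝ᵥ z + b₀ * ∑ i, z i := by
      change bj ⬝ᵥ Δ = _
      rw [hbjA, ← hΔ, dotProduct_comm, dotProduct_mulVec, ← mulVec_transpose, hAsymm,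
        add_comm c, dotProduct_add, dotProduct_smul, dotProduct_comm (A *ᵥ Δ) c]
      simp [dotProduct]
      ring
    have hcol : ∀ i : Fin q, |(A *ᵥ c) i| ≤ t * (1 + B) := by
      intro i
      rw [hc]
      have hsum : ∑ k : Fin q, exchangeableCov q r α₁ α₂ α₃ (Sum.inl i) (Sum.inl k) = s₀ := by
        have h3 := exchangeableCov_toBlocks₁₁_mulVec (q := q) (r := r) (α₁ := α₁) (α₂ := α₂)
          (α₃ := α₃) (fun _ => 1) i
        simp only [mulVec, dotProduct, toBlocks₁₁, of_apply, mul_one, Finset.sum_const,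
          Finset.card_univ, Fintype.card_fin, nsmul_eq_mul] at h3
        rw [h3, hs₀]
        ring
      have h2 : (bj - b₀ • (A *ᵥ fun _ => 1)) i =
          (G (Sum.inr j) (Sum.inl i) -
            exchangeableCov q r α₁ α₂ α₃ (Sum.inr j) (Sum.inl i)) -
          b₀ * ∑ k, (A i k - exchangeableCov q r α₁ α₂ α₃ (Sum.inl i) (Sum.inl k)) := by
        have h4 : exchangeableCov q r α₁ α₂ α₃ (Sum.inr j) (Sum.inl i) = b₀ * s₀ := by
          rw [hb₀, div_mul_cancel₀ _ hs.ne']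
          simp [exchangeableCov]
        rw [Finset.sum_sub_distrib, hsum, h4]
        simp only [Pi.sub_apply, Pi.smul_apply, smul_eq_mul, mulVec, dotProduct, mul_one, hbj]
        ring
      rw [h2]
      refine (abs_sub _ _).trans ?_
      have h5 := abs_sum_le_card_mul (fun k : Fin q => hG' (Sum.inl i) (Sum.inl k))
      rw [Fintype.card_fin] at h5
      have h6 : |b₀ * ∑ k, (A i k - exchangeableCov q r α₁ α₂ α₃ (Sum.inl i) (Sum.inl k))| ≤
          B * t := by
        rw [abs_mul, hb₀abs]
        calc _ ≤ |α₂| / s₀ * (q * t) := by gcongr; exact h5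
          _ = (q * (|α₂| / s₀)) * t := by ring
          _ ≤ _ := by gcongr
      linarith [hG' (Sum.inr j) (Sum.inl i)]
    have hcz : |c ⬝ᵥ z| ≤ q * t * (1 + B) * (t + τ * K) / κ := by
      have h2 := mul_sqrt_le_sqrt_of_coercive hAcoer c
      have h3 := sqrt_dotProduct_self_le (by positivity) hcol
      rw [Fintype.card_fin] at h3
      have h4 : √(c ⬝ᵥ c) ≤ √q * (t * (1 + B)) / κ := by
        rw [le_div_iff₀ hκ]
        linarith
      calc _ ≤ √(c ⬝ᵥ c) * √(z ⬝ᵥ z) := abs_dotProduct_le_sqrt_mul_sqrt c z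
        _ ≤ (√q * (t * (1 + B)) / κ) * (√q * (t + τ * K)) := by gcongr
        _ = (√q * √q) * t * (1 + B) * (t + τ * K) / κ := by ring
        _ = _ := by rw [Real.mul_self_sqrt (by positivity)]
    rw [h1]
    have h7 := abs_sub (u (Sum.inr j)) (c ⬝ᵥ z + b₀ * ∑ i, z i)
    have h8 := abs_add_le (c ⬝ᵥ z) (b₀ * ∑ i, z i)
    have h9 := hu' (Sum.inr j)
    have h10 : τ * (√b - t') ≤ τ * √(d (Sum.inr j)) := by
      gcongr
      linarith [(abs_le.1 (hdb j)).1]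
    linarith
  set h : Fin q ⊕ Fin r → ℝ := Sum.elim (fun i => β (Sum.inl i) + Δ i) (fun _ => 0) with hh
  -- Back from the `β` scale to the SPAC scale, which leaves signs unchanged.
  set g₀ : Fin q ⊕ Fin r → ℝ := fun j => h j / √(d j) with hg₀
  have hsd : ∀ j, 0 < √(d j) := fun j => Real.sqrt_pos.2 (hd j)
  have hsignh : ∀ j, SignType.sign (h j) = SignType.sign (β j) := by
    rintro (i | j)
    · exact sign_add_eq_of_abs_lt (hΔβ i)
    · simp [hh, hβ₂]
  have hsign : ∀ j, SignType.sign (g₀ j) = SignType.sign (β j) := by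
    intro j
    simp only [hg₀]
    rw [div_eq_mul_inv, sign_mul, sign_pos (inv_pos.2 (hsd j)), mul_one, hsignh]
  have hres : ∀ i, response x β e i - ∑ k, x i k * √(d k) * g₀ k =
      e i - ∑ k, x i (Sum.inl k) * Δ k := by
    intro i
    have h1 : ∀ k, x i k * √(d k) * g₀ k = x i k * h k := by
      intro k
      have := (hsd k).ne'
      simp only [hg₀]
      field_simp
    simp only [h1, response, Fintype.sum_sum_type, hβ₂, hh, Sum.elim_inl, Sum.elim_inr, mul_zero,
      Finset.sum_const_zero, mul_add, Finset.sum_add_distrib]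
    ring
  have hgrad : ∀ j, ∑ i, x i j * (response x β e i - ∑ k, x i k * √(d k) * g₀ k) =
      n * (u j - ∑ k, G j (Sum.inl k) * Δ k) := by
    intro j
    have e1 : n * u j = ∑ i, x i j * e i := by simp only [hudef]; field_simp
    have e2 : n * ∑ k, G j (Sum.inl k) * Δ k = ∑ i, x i j * ∑ k, x i (Sum.inl k) * Δ k := by
      simp only [Finset.mul_sum]
      rw [Finset.sum_comm]
      refine Finset.sum_congr rfl fun k _ => ?_
      simp only [hGdef, of_apply]
      rw [div_mul_eq_mul_div, mul_div_cancel₀ _ hn'.ne', Finset.sum_mul]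
      exact Finset.sum_congr rfl fun i _ => by ring
    rw [mul_sub, e1, e2, ← Finset.sum_sub_distrib]
    exact Finset.sum_congr rfl fun i _ => by rw [hres, mul_sub]
  obtain ⟨hmin, huniq⟩ := isSpacLasso_unique_of_kkt x (response x β e) d (n * τ) (by positivity)
    hd g₀ (Set.range Sum.inl)
    (by
      rintro _ ⟨i, rfl⟩
      rw [hgrad, hsign]
      have h1 : ∑ k, G (Sum.inl i) (Sum.inl k) * Δ k = z i := by rw [← hΔ]; rfl
      rw [h1]
      have h2 := Real.mul_self_sqrt (hd (Sum.inl i)).le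
      simp only [hzdef, hsdef]
      linear_combination (n * τ * (SignType.sign (β (Sum.inl i)) : ℝ)) * h2)
    (by
      rintro (i | j) hj
      · exact absurd ⟨i, rfl⟩ hj
      refine ⟨by simp [hg₀, hh], ?_⟩
      rw [hgrad, abs_mul, abs_mul, abs_of_pos hn', abs_of_pos (hsd _)]
      have h1 := hdualj j
      have h2 := Real.mul_self_sqrt (hd (Sum.inr j)).le
      calc _ < √(d (Sum.inr j)) * (n * (τ * √(d (Sum.inr j)))) :=
            mul_lt_mul_of_pos_left (mul_lt_mul_of_pos_left h1 hn') (hsd _)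
        _ = n * τ * (√(d (Sum.inr j)) * √(d (Sum.inr j))) := by ring
        _ = _ := by rw [h2])
    (by
      intro v hv hxv
      have hv2 : ∀ j, v (Sum.inr j) = 0 := fun j => hv _ (by simp)
      set v₁ : Fin q → ℝ := fun i => v (Sum.inl i) with hv₁
      have h1 : A *ᵥ v₁ = 0 := by
        ext i
        have e3 : (A *ᵥ v₁) i = (∑ l, x l (Sum.inl i) * ∑ k, x l k * v k) / n := by
          simp only [hAdef, hGdef, hv₁, mulVec, dotProduct, of_apply, Fintype.sum_sum_type, hv2,
            mul_zero, Finset.sum_const_zero, add_zero, Finset.mul_sum]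
          rw [Finset.sum_comm, Finset.sum_div]
          refine Finset.sum_congr rfl fun k _ => ?_
          rw [div_mul_eq_mul_div, Finset.sum_mul]
          congr 1
          exact Finset.sum_congr rfl fun l _ => by ring
        rw [e3]
        simp [hxv]
      have h2 := hAcoer v₁
      rw [h1, dotProduct_zero] at h2
      have h3 : 0 ≤ v₁ ⬝ᵥ v₁ := Finset.sum_nonneg fun i _ => mul_self_nonneg _
      have h4 : v₁ ⬝ᵥ v₁ = 0 := by nlinarith
      have h5 := dotProduct_self_eq_zero.1 h4
      ext (i | j)
      · exact congrFun h5 i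
      · exact hv2 j)
  exact ⟨⟨g₀, hmin⟩, fun g hg j => by rw [huniq g hg]; exact hsign j⟩
end

/-! ### Union bound over all sample covariances -/

section
variable {Ω : Type*} [MeasurableSpace Ω] {μ : Measure Ω} [IsProbabilityMeasure μ]
  {ι : Type*} [Fintype ι] [DecidableEq ι] {n : ℕ} {C : Matrix ι ι ℝ} {σ : ℝ}
  {x : Ω → Fin n → EuclideanSpace ℝ ι} {ε : Ω → Fin n → ℝ}

/-- All sample covariances among the covariates and the noise are simultaneously close to their
population values. -/
lemma IsGaussianSample.measure_deviation_le (h : IsGaussianSample μ C σ x ε)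
    (hC : C.PosSemidef) (h1 : ∀ i, C i i = 1) {V t : ℝ} (hV : 1 + σ ^ 2 ≤ V)
    (ht0 : 0 ≤ t) (ht : t ≤ 4) (htV : t ≤ V) :
    μ {ω | ¬ ((∀ k l, |∑ i, x ω i k * x ω i l - n * C k l| ≤ n * t) ∧
      ∀ k, |∑ i, x ω i k * ε ω i| ≤ n * t)} ≤
      ENNReal.ofReal (8 * (Fintype.card ι : ℝ) ^ 2 *
        Real.exp (-(n * t ^ 2 / (128 + 8 * V ^ 2)))) := by
  have hV0 : 0 < V := by nlinarith [sq_nonneg σ]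
  -- The denominator dominates both `128` (covariate pairs) and `8 V²` (noise), giving one rate for
  -- all `p² + p` events.
  set E := Real.exp (-(n * t ^ 2 / (128 + 8 * V ^ 2))) with hE
  have hE0 : 0 ≤ E := (Real.exp_pos _).le
  have hsub : {ω | ¬ ((∀ k l, |∑ i, x ω i k * x ω i l - n * C k l| ≤ n * t) ∧
      ∀ k, |∑ i, x ω i k * ε ω i| ≤ n * t)} ⊆
      (⋃ p : ι × ι, {ω | n * t < |∑ i, x ω i p.1 * x ω i p.2 - n * C p.1 p.2|}) ∪
      ⋃ k : ι, {ω | n * t < |∑ i, x ω i k * ε ω i|} := by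
    intro ω hω
    rw [Set.mem_ofPred_eq, not_and_or] at hω
    push Not at hω
    rcases hω with ⟨k, l, hkl⟩ | ⟨k, hk⟩
    · exact Or.inl (Set.mem_iUnion.2 ⟨(k, l), hkl⟩)
    · exact Or.inr (Set.mem_iUnion.2 ⟨k, hk⟩)
  have b1 : ∀ p : ι × ι, μ {ω | n * t < |∑ i, x ω i p.1 * x ω i p.2 - n * C p.1 p.2|} ≤
      ENNReal.ofReal (4 * E) := fun p => by
    refine (h.measure_gram_sub_gt_le hC h1 p.1 p.2 ht0 ht).trans (ENNReal.ofReal_le_ofReal ?_)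
    rw [hE]
    gcongr
    nlinarith [sq_nonneg V]
  have b2 : ∀ k : ι, μ {ω | n * t < |∑ i, x ω i k * ε ω i|} ≤ ENNReal.ofReal (4 * E) := fun k => by
    refine (h.measure_noise_gt_le hC h1 k hV ht0 htV).trans (ENNReal.ofReal_le_ofReal ?_)
    rw [hE]
    gcongr
    linarith
  have hcard : (Fintype.card ι : ℝ) ≤ (Fintype.card ι : ℝ) ^ 2 := by
    exact_mod_cast Nat.le_self_pow two_ne_zero _
  calc _ ≤ _ := measure_mono hsub
    _ ≤ _ := measure_union_le _ _
    _ ≤ _ := add_le_add (measure_iUnion_fintype_le μ _) (measure_iUnion_fintype_le μ _)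
    _ ≤ _ := add_le_add (Finset.sum_le_sum fun p _ => b1 p) (Finset.sum_le_sum fun k _ => b2 k)
    _ = ENNReal.ofReal ((Fintype.card ι : ℝ) ^ 2 * (4 * E)) +
        ENNReal.ofReal ((Fintype.card ι : ℝ) * (4 * E)) := by
      rw [Finset.sum_const, Finset.sum_const, Finset.card_univ, Finset.card_univ,
        Fintype.card_prod, nsmul_eq_mul, nsmul_eq_mul,
        ENNReal.ofReal_mul (p := (Fintype.card ι : ℝ) ^ 2) (by positivity),
        ENNReal.ofReal_mul (p := (Fintype.card ι : ℝ)) (by positivity),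
        
        ENNReal.ofReal_pow (by positivity), ENNReal.ofReal_natCast, Nat.cast_mul, sq]
    _ ≤ _ := by
      rw [← ENNReal.ofReal_add (by positivity) (by positivity)]
      apply ENNReal.ofReal_le_ofReal
      nlinarith
end

/-! ### Rates, and the inequalities they feed -/

/-- The rates implied by the growth conditions. -/
lemma eventually_rates {q : ℕ → ℕ} (hq : Tendsto q atTop atTop)
    (hqn : (fun n => (q n : ℝ)) =o[atTop] fun n : ℕ => ((n : ℝ) / Real.log n) ^ (1 / 3 : ℝ))
    {l lam : ℕ → ℝ} (hl : ∀ n, 0 < l n) (hlam : ∀ n, 0 ≤ lam n)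
    (hlam₁ : (fun n : ℕ => √((q n : ℝ) * n * Real.log n)) =o[atTop] lam)
    (hlam₃ : (fun n : ℕ => √(q n : ℝ) * lam n / n) =o[atTop] l)
    {M : ℝ} (hM : 0 < M) {c : ℝ} (hc : 0 < c) :
    ∀ᶠ n : ℕ in atTop, 0 < lam n ∧ q n * (M * √(Real.log n / n)) ≤ c ∧
      M * √(Real.log n / n) ≤ c ∧ M * √(Real.log n / n) ≤ c * (lam n / n) ∧
      √(q n) * (lam n / n) ≤ c * l n := by
  have hcM : 0 < c / M := by positivity
  filter_upwards [hqn.bound hcM, hlam₁.bound hcM, hlam₃.bound hc, hq.eventually_ge_atTop 1,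
    eventually_ge_atTop 3] with n h1 h2 h3 h4 h5
  have hn : (3 : ℝ) ≤ n := by exact_mod_cast h5
  have hn0 : (0 : ℝ) < n := by linarith
  have hlog : 0 < Real.log n := Real.log_pos (by linarith)
  have hlogn : Real.log n ≤ n := by linarith [Real.log_le_sub_one_of_pos hn0]
  have hq1 : (1 : ℝ) ≤ q n := by exact_mod_cast h4
  have hsq : 0 ≤ √(Real.log n / n) := Real.sqrt_nonneg _
  have hqT : q n * (M * √(Real.log n / n)) ≤ c := by
    rw [Real.norm_of_nonneg (by positivity), Real.norm_of_nonneg (by positivity)] at h1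
    -- Since `n / log n ≥ 1`, its cube root is at most its square root, the inverse of `√(log n /
    -- n)`.
    have h6 : ((n : ℝ) / Real.log n) ^ (1 / 3 : ℝ) ≤ √((n : ℝ) / Real.log n) := by
      rw [Real.sqrt_eq_rpow]
      exact Real.rpow_le_rpow_of_exponent_le ((one_le_div hlog).2 hlogn) (by norm_num)
    have h7 : √((n : ℝ) / Real.log n) * √(Real.log n / n) = 1 := by
      rw [← Real.sqrt_mul (by positivity), div_mul_div_cancel₀ hlog.ne', div_self hn0.ne',
        Real.sqrt_one]
    calc q n * (M * √(Real.log n / n))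
        ≤ (c / M * √((n : ℝ) / Real.log n)) * (M * √(Real.log n / n)) := by
          gcongr
          exact h1.trans (by gcongr)
      _ = c * (√((n : ℝ) / Real.log n) * √(Real.log n / n)) := by field_simp
      _ = c := by rw [h7, mul_one]
  rw [Real.norm_of_nonneg (Real.sqrt_nonneg _), Real.norm_of_nonneg (hlam n)] at h2
  rw [Real.norm_of_nonneg (by have := hlam n; positivity), Real.norm_of_nonneg (hl n).le] at h3
  have h8 : 0 < √((q n : ℝ) * n * Real.log n) := Real.sqrt_pos.2 (by positivity)
  have hlampos : 0 < lam n := by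
    by_contra hcon
    have : lam n = 0 := le_antisymm (not_lt.1 hcon) (hlam n)
    rw [this, mul_zero] at h2
    linarith
  refine ⟨hlampos, hqT, ?_, ?_, ?_⟩
  · refine le_trans ?_ hqT
    exact le_mul_of_one_le_left (by positivity) hq1
  · have h9 : √(Real.log n / n) = √((n : ℝ) * Real.log n) / n := by
      rw [eq_div_iff hn0.ne']
      calc _ = √(Real.log n / n) * √((n : ℝ) ^ 2) := by rw [Real.sqrt_sq hn0.le]
        _ = _ := by
          rw [← Real.sqrt_mul (by positivity)]
          congr 1
          field_simp
    have h10 : √((n : ℝ) * Real.log n) ≤ c / M * lam n := by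
      refine le_trans (Real.sqrt_le_sqrt ?_) h2
      rw [mul_assoc]
      exact le_mul_of_one_le_left (by positivity) hq1
    calc M * √(Real.log n / n) ≤ M * (c / M * lam n / n) := by rw [h9]; gcongr
      _ = c * (lam n / n) := by field_simp
  · rw [← mul_div_assoc]
    exact h3

lemma eventually_half_le_exchangeablePrecDiag {q r : ℕ → ℕ} (hq : Tendsto q atTop atTop)
    {α₁ α₂ α₃ : ℝ} (h₁ : α₁ < 1) (h₃ : α₃ < 1) (hn₁ : 0 ≤ α₁) (hn₃ : 0 ≤ α₃)
    (h₂ : α₂ ^ 2 ≤ α₁ * α₃) :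
    ∀ᶠ n in atTop, 1 / 2 ≤ exchangeablePrecDiag (q n) (r n) α₁ α₂ α₃ ∧
      exchangeablePrecDiag (q n) (r n) α₁ α₂ α₃ ≤ 1 / (1 - α₁) := by
  filter_upwards [hq.eventually_ge_atTop 2] with n hn
  obtain ⟨h5, h6⟩ := exchangeablePrecDiag_bounds (q := q n) (r := r n) (by omega) h₁ h₃ hn₁ hn₃ h₂
  refine ⟨le_trans ?_ h5, h6⟩
  have h7 : 1 ≤ 1 / (1 - α₁) := (one_le_div (by linarith)).2 (by linarith)
  have h8 : 1 / (1 - α₁) / (q n : ℝ) ≤ 1 / (1 - α₁) / 2 := by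
    have : (2 : ℝ) ≤ q n := by exact_mod_cast hn
    gcongr
  linarith

lemma abs_sqrt_sub_sqrt_le {u v : ℝ} (hu : 1 / 4 ≤ u) (hv : 1 / 4 ≤ v) :
    |√u - √v| ≤ |u - v| := by
  have h : (1 / 2 : ℝ) = √(1 / 4) := by
    rw [show (1 / 4 : ℝ) = (1 / 2) ^ 2 by norm_num, Real.sqrt_sq (by norm_num)]
  have h1 : 1 / 2 ≤ √u := by rw [h]; exact Real.sqrt_le_sqrt hu
  have h2 : 1 / 2 ≤ √v := by rw [h]; exact Real.sqrt_le_sqrt hv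
  have e : u - v = (√u - √v) * (√u + √v) := by
    have := Real.mul_self_sqrt (show 0 ≤ u by linarith)
    have := Real.mul_self_sqrt (show 0 ≤ v by linarith)
    linarith
  rw [e, abs_mul, abs_of_pos (show 0 < √u + √v by linarith)]
  exact le_mul_of_one_le_right (abs_nonneg _) (by linarith)

/-- The beta-min inequality of the primal-dual witness. -/
lemma sqrt_mul_add_lt_of_rates {Q₀ T τ K κ₁ c l₀ b₀ : ℝ} (hK : 0 ≤ K) (hτ : 0 ≤ τ)
    (hκ₁ : 0 < κ₁) (hc : c ≤ 1) (hc3 : c * (4 * (1 + K)) ≤ κ₁) (hl : 0 < l₀)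
    (hTτ : T ≤ c * τ) (hτl : √Q₀ * τ ≤ c * l₀) (hb : l₀ * (1 / 2) ≤ b₀) :
    √Q₀ * (T + τ * K) < κ₁ * b₀ := by
  have h5 : T ≤ τ := hTτ.trans (mul_le_of_le_one_left hτ hc)
  have h6 := mul_le_mul_of_nonneg_left h5 (Real.sqrt_nonneg Q₀)
  have h8 : (1 + K) * (√Q₀ * τ) ≤ (1 + K) * (c * l₀) := by gcongr
  have h9 := mul_le_mul_of_nonneg_right hc3 hl.le
  have h10 := mul_le_mul_of_nonneg_left hb hκ₁.le
  have h11 : 0 < κ₁ * l₀ := mul_pos hκ₁ hl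
  linarith

/-- The strict dual feasibility inequality of the primal-dual witness. -/
lemma dual_feasible_of_rates {Q₀ T τ K κ₁ c B η' w : ℝ} (hT : 0 ≤ T) (hK : 0 ≤ K)
    (hτ : 0 < τ) (hκ₁ : 0 < κ₁) (hB : 0 ≤ B) (hη' : 0 < η') (hc0 : 0 ≤ c) (hc1 : c ≤ 1)
    (hc4 : c * (4 * ((1 + B) + B + (1 + B) * (1 + K) / κ₁ + 1)) ≤ η')
    (hqT : Q₀ * T ≤ c) (hTc : T ≤ c) (hTτ : T ≤ c * τ) (hw : 1 / 2 ≤ w) :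
    T + B * T + τ * ((1 - η') * w + B * T) + Q₀ * T * (1 + B) * (T + τ * K) / κ₁ <
      τ * (w - T) := by
  have f1 : T + B * T ≤ τ * ((1 + B) * c) := by
    have := mul_le_mul_of_nonneg_left hTτ (show 0 ≤ 1 + B by linarith)
    linarith
  have f2 : τ * ((1 - η') * w + B * T) ≤ τ * ((1 - η') * w + B * c) := by gcongr
  have f3 : Q₀ * T * (1 + B) * (T + τ * K) / κ₁ ≤ τ * (c * ((1 + B) * (1 + K) / κ₁)) := by
    have : T ≤ τ := hTτ.trans (mul_le_of_le_one_left hτ.le hc1)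
    calc _ ≤ c * (1 + B) * (τ + τ * K) / κ₁ := by gcongr
      _ = _ := by ring
  have f4 : τ * (w - c) ≤ τ * (w - T) := by gcongr
  -- After division by `τ` the errors add up to at most `η'/4`, below the slack `η' w ≥ η'/2`.
  have f5 : (1 + B) * c + ((1 - η') * w + B * c) + c * ((1 + B) * (1 + K) / κ₁) < w - c := by
    have g2 : η' * (1 / 2) ≤ η' * w := by gcongr
    linarith
  have f6 := mul_lt_mul_of_pos_left f5 hτ
  linarith

/-- A bound free of `q` on the `ℓ¹` norm of the population regression coefficients. If `α₁ = 0` then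
`α₂ = 0`, and both sides are `0`. -/
lemma mul_abs_div_exchangeable_rowSum_le {q : ℕ} {α₁ α₂ α₃ : ℝ} (h₁ : α₁ < 1) (hn₁ : 0 ≤ α₁)
    (h₂ : α₂ ^ 2 ≤ α₁ * α₃) : q * (|α₂| / (1 - α₁ + q * α₁)) ≤ |α₂| / α₁ := by
  rcases hn₁.eq_or_lt with h0 | h0
  · have : α₂ = 0 := by
      rw [← h0, zero_mul] at h₂
      exact pow_eq_zero_iff two_ne_zero |>.1 (le_antisymm h₂ (sq_nonneg _))
    simp [this]
  · have a1 : 0 < 1 - α₁ := by linarith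
    rw [mul_div_assoc', div_le_div_iff₀ (by positivity) h0]
    linarith [mul_nonneg (abs_nonneg α₂) a1.le]

/-! ### Sign consistency and conclusion -/

/-- SPAC-Lasso is sign consistent for block-exchangeable designs whose irrepresentable vector is
bounded away from `1`. -/
lemma signConsistentAlong_of_irrep {Ω : Type*} [MeasurableSpace Ω] (μ : Measure Ω)
    [IsProbabilityMeasure μ] (q r : ℕ → ℕ) (hq : Tendsto q atTop atTop)
    (hr : Tendsto r atTop atTop) (α₁ α₂ α₃ : ℝ) (h₁ : α₁ < 1) (h₃ : α₃ < 1)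
    (hC : ∀ n, (exchangeableCov (q n) (r n) α₁ α₂ α₃).PosDef)
    (β : ∀ n, Fin (q n) ⊕ Fin (r n) → ℝ) (hβ₂ : ∀ n j, β n (Sum.inr j) = 0)
    (σ : ℕ → ℝ) (hσ : ∀ n, 0 < σ n) (s : ℝ) (hσ' : ∀ n, σ n ≤ s)
    (γ : ∀ n, Fin (q n) ⊕ Fin (r n) → ℝ)
    (hγ : ∀ n j, γ n j =
      spac (jointCov (exchangeableCov (q n) (r n) α₁ α₂ α₃) (β n) (σ n)) j)
    {η' : ℝ} (hη' : 0 < η')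
    (hirrep : ∀ᶠ n in atTop, |α₂| / (1 - α₁ + q n * α₁) *
      √(exchangeablePrecDiag (q n) (r n) α₁ α₂ α₃) * signImbalance (β n) ≤
        (1 - η') * √(exchangeablePrecDiag (r n) (q n) α₃ α₂ α₁))
    (x : ∀ n, Ω → Fin n → EuclideanSpace ℝ (Fin (q n) ⊕ Fin (r n)))
    (ε : ∀ n, Ω → Fin n → ℝ)
    (hdata : ∀ n, IsGaussianSample μ (exchangeableCov (q n) (r n) α₁ α₂ α₃) (σ n) (x n) (ε n))
    (dhat : ∀ n, Ω → Fin (q n) ⊕ Fin (r n) → ℝ)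
    (hdhat : PrecisionEstimatorAccurate μ q r
      (fun n => exchangeableCov (q n) (r n) α₁ α₂ α₃) dhat)
    (κ : ℝ) (hκ : 0 ≤ κ)
    (hp : (fun n => ((q n + r n : ℕ) : ℝ)) =O[atTop] fun n : ℕ => (n : ℝ) ^ κ)
    (hqn : (fun n => (q n : ℝ)) =o[atTop] fun n : ℕ => ((n : ℝ) / Real.log n) ^ (1 / 3 : ℝ))
    (l : ℕ → ℝ) (hl : ∀ n, 0 < l n) (hγl : ∀ n i, l n ≤ |γ n (Sum.inl i)|)
    (lam : ℕ → ℝ) (hlam : ∀ n, 0 ≤ lam n)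
    (hlam₁ : (fun n : ℕ => √((q n : ℝ) * n * Real.log n)) =o[atTop] lam)
    (hlam₃ : (fun n : ℕ => √(q n : ℝ) * lam n / n) =o[atTop] l) :
    SignConsistentAlong μ q r x (fun n ω => response (x n ω) (β n) (ε n ω)) dhat γ lam := by
  obtain ⟨hn₁, hn₃, h₂⟩ := exchangeable_parameters_of_posDef hq hr hC
  have a1 : 0 < 1 - α₁ := by linarith
  have a3 : 0 < 1 - α₃ := by linarith
  obtain ⟨M₁, hM₁, K₁, hM₁K⟩ := hdhat 1 one_pos
  obtain ⟨c₀, hc₀⟩ := hp.bound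
  set V : ℝ := 4 + s ^ 2 with hV
  have hs0 : 0 < s := (hσ 0).trans_le (hσ' 0)
  set W : ℝ := 128 + 8 * V ^ 2 with hW
  have hW0 : 0 < W := by positivity
  -- With `M² ≥ W (2κ + 1)` the tail is at most `n^(-(2κ+1))`, which absorbs the `p² = O(n^(2κ))`
  -- events and leaves `1/n`.
  set M : ℝ := max M₁ √(W * (2 * κ + 1)) with hM
  have hM0 : 0 < M := lt_max_of_lt_left hM₁
  have hM2 : W * (2 * κ + 1) ≤ M ^ 2 := by
    rw [← Real.sq_sqrt (show 0 ≤ W * (2 * κ + 1) by positivity)]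
    exact pow_le_pow_left₀ (Real.sqrt_nonneg _) (le_max_right _ _) 2
  set κ₁ : ℝ := (1 - α₁) / 2 with hκ₁
  have hκ₁0 : 0 < κ₁ := by positivity
  set K : ℝ := 1 / (1 - α₁) + 1 / (1 - α₃) + 2 with hK
  have hK0 : 0 < K := by positivity
  set B : ℝ := |α₂| / α₁ with hB
  have hB0 : 0 ≤ B := by positivity
  set Q : ℝ := (1 + B) + B + (1 + B) * (1 + K) / κ₁ + 1 with hQ
  have hQ0 : 0 < Q := by positivity
  -- The four bounds on `c` serve, in order, to keep `d̂ ≥ 1/4`, to make the relevant Gram block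
  -- coercive, to preserve signs, and to secure dual feasibility.
  set c : ℝ := min (min (1 / 4) κ₁) (min (κ₁ / (4 * (1 + K))) (η' / (4 * Q))) with hc
  have hc0 : 0 < c := by
    simp only [hc, lt_min_iff]
    exact ⟨⟨by norm_num, hκ₁0⟩, by positivity, by positivity⟩
  have hc1 : c ≤ 1 / 4 := (min_le_left _ _).trans (min_le_left _ _)
  have hc2 : c ≤ κ₁ := (min_le_left _ _).trans (min_le_right _ _)
  have hc3 : c * (4 * (1 + K)) ≤ κ₁ :=
    (le_div_iff₀ (by positivity)).1 ((min_le_right _ _).trans (min_le_left _ _))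
  have hc4 : c * (4 * Q) ≤ η' :=
    (le_div_iff₀ (by positivity)).1 ((min_le_right _ _).trans (min_le_right _ _))
  have hgood : ∀ᶠ n : ℕ in atTop,
      {ω | ¬ ((∃ g, IsSpacLasso (x n ω) (response (x n ω) (β n) (ε n ω)) (dhat n ω) (lam n) g) ∧
        ∀ g, IsSpacLasso (x n ω) (response (x n ω) (β n) (ε n ω)) (dhat n ω) (lam n) g →
          ∀ j, SignType.sign (g j) = SignType.sign (γ n j))} ⊆
      {ω | ¬ ((∀ k l, |∑ i, x n ω i k * x n ω i l -
          n * exchangeableCov (q n) (r n) α₁ α₂ α₃ k l| ≤ n * (M * √(Real.log n / n))) ∧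
        ∀ k, |∑ i, x n ω i k * ε n ω i| ≤ n * (M * √(Real.log n / n)))} ∪
      {ω | ¬ ∀ j, |dhat n ω j - (exchangeableCov (q n) (r n) α₁ α₂ α₃)⁻¹ j j| ≤
        M₁ * √(Real.log n / n)} := by
    filter_upwards [eventually_rates hq hqn hl hlam hlam₁ hlam₃ hM0 hc0,
      eventually_half_le_exchangeablePrecDiag (r := r) hq h₁ h₃ hn₁ hn₃ h₂,
      eventually_half_le_exchangeablePrecDiag (r := q) hr h₃ h₁ hn₃ hn₁
        (h₂.trans_eq (mul_comm α₁ α₃)), hirrep, eventually_gt_atTop 0, hq.eventually_gt_atTop 0]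
      with n hrate ha hb hir hn hqn0
    obtain ⟨hlampos, hqT, hT, hTτ, hτl⟩ := hrate
    obtain ⟨ha1, ha2⟩ := ha
    obtain ⟨hb1, hb2⟩ := hb
    have hn' : (0 : ℝ) < n := by exact_mod_cast hn
    have hqpos : (0 : ℝ) < q n := by exact_mod_cast hqn0
    intro ω hω
    by_contra hcon
    simp only [Set.mem_union, Set.mem_ofPred_eq, not_or, not_not] at hcon
    obtain ⟨⟨hG, hu⟩, hdh⟩ := hcon
    apply hω
    set T := M * √(Real.log n / n) with hTdef
    have hT0 : 0 ≤ T := by positivity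
    set a := exchangeablePrecDiag (q n) (r n) α₁ α₂ α₃ with hadef
    set b := exchangeablePrecDiag (r n) (q n) α₃ α₂ α₁ with hbdef
    set τ := lam n / n with hτdef
    have hτ0 : 0 < τ := by positivity
    obtain ⟨hinv1, hinv2⟩ := exchangeableCov_inv (q := q n) (r := r n) h₁ h₃
      (exchangeable_det_pos h₁ h₃ hn₁ hn₃ h₂).ne'
    have hdev : ∀ j, |dhat n ω j - (exchangeableCov (q n) (r n) α₁ α₂ α₃)⁻¹ j j| ≤ T := fun j =>
      (hdh j).trans (by rw [hTdef]; gcongr; exact le_max_left _ _)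
    have hdiag : ∀ j, 1 / 2 ≤ (exchangeableCov (q n) (r n) α₁ α₂ α₃)⁻¹ j j ∧
        (exchangeableCov (q n) (r n) α₁ α₂ α₃)⁻¹ j j ≤ K - 2 := by
      have p1 : 0 < 1 / (1 - α₁) := by positivity
      have p3 : 0 < 1 / (1 - α₃) := by positivity
      rintro (i | j)
      · rw [hinv1]; exact ⟨ha1, by linarith⟩
      · rw [hinv2]; exact ⟨hb1, by linarith⟩
    have hdlow : ∀ j, 1 / 4 ≤ dhat n ω j := fun j => by
      linarith [(abs_le.1 (hdev j)).1, (hdiag j).1]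
    have hdK : ∀ j, √(dhat n ω j) ≤ K := fun j => by
      rw [Real.sqrt_le_left hK0.le]
      have : dhat n ω j ≤ K := by linarith [(abs_le.1 (hdev j)).2, (hdiag j).2]
      have h2K : 2 ≤ K := by
        have := (hdiag (Sum.inl ⟨0, hqn0⟩))
        linarith [this.1, this.2]
      -- The summand `2` in `K` both absorbs the error of `d̂` and ensures `K ≤ K²`, whence `√d̂ ≤
      -- K`.
      exact this.trans (le_self_pow₀ (by linarith) two_ne_zero)
    have hsq : ∀ j, |√(dhat n ω j) - √((exchangeableCov (q n) (r n) α₁ α₂ α₃)⁻¹ j j)| ≤ T :=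
      fun j => (abs_sqrt_sub_sqrt_le (hdlow j) (by linarith [(hdiag j).1])).trans (hdev j)
    have hsqrt_half : ∀ v : ℝ, 1 / 2 ≤ v → 1 / 2 ≤ √v := fun v hv =>
      Real.le_sqrt_of_sq_le (by linarith)
    have hsgn : ∀ j, SignType.sign (γ n j) = SignType.sign (β n j) := fun j => by
      rw [hγ, sign_spac_jointCov (hC n) _ (hσ n)]
    have hs0 : 0 < 1 - α₁ + q n * α₁ := by positivity
    have key := spacLasso_sign_of_deviation_le (α₃ := α₃) hn (x n ω) (ε n ω) (β n) (dhat n ω)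
      (hβ₂ n)
      (t := T) (t' := T) (κ := κ₁) (B := B) (K := K) (τ := τ) (ρ := (1 - η') * √b)
      (a := a) (b := b) hn₁ hs0 hT0 hT0 hK0.le hτ0 hκ₁0 (by linarith)
      (mul_abs_div_exchangeable_rowSum_le h₁ hn₁ h₂)
      hG hu (fun j => by linarith [hdlow j]) hdK
      (fun i => by rw [hadef, ← hinv1 i]; exact hsq _)
      (fun j => by rw [hbdef, ← hinv2 j]; exact hsq _)
      hir
      (by
        intro i
        have hβγ : |γ n (Sum.inl i)| * √a = |β n (Sum.inl i)| := by
          have hsa : 0 < √a := by linarith [hsqrt_half a ha1]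
          rw [hγ, spac_jointCov (hC n) _ (hσ n), hinv1, abs_div, abs_of_pos hsa,
            div_mul_cancel₀ _ hsa.ne']
        have h5 : l n * (1 / 2) ≤ |β n (Sum.inl i)| := by
          rw [← hβγ]
          exact mul_le_mul (hγl n i) (hsqrt_half a ha1) (by norm_num) (abs_nonneg _)
        exact sqrt_mul_add_lt_of_rates hK0.le hτ0.le hκ₁0 (by linarith) hc3 (hl n) hTτ hτl h5)
      (dual_feasible_of_rates hT0 hK0.le hτ0 hκ₁0 hB0 hη' hc0.le (by linarith) hc4 hqT hT hTτ
        (hsqrt_half b hb1))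
    rw [hτdef, mul_div_cancel₀ _ hn'.ne'] at key
    exact ⟨key.1, fun g hg j => by rw [key.2 g hg j, hsgn]⟩
  have hbound : ∀ᶠ n : ℕ in atTop,
      μ {ω | ¬ ((∃ g, IsSpacLasso (x n ω) (response (x n ω) (β n) (ε n ω)) (dhat n ω) (lam n) g) ∧
        ∀ g, IsSpacLasso (x n ω) (response (x n ω) (β n) (ε n ω)) (dhat n ω) (lam n) g →
          ∀ j, SignType.sign (g j) = SignType.sign (γ n j))} ≤
      ENNReal.ofReal (8 * c₀ ^ 2 * (n : ℝ) ^ (-1 : ℝ)) +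
        ENNReal.ofReal (K₁ * (n : ℝ) ^ (-1 : ℝ)) := by
    filter_upwards [hgood, hM₁K, hc₀, eventually_rates hq hqn hl hlam hlam₁ hlam₃ hM0 one_pos,
      eventually_gt_atTop 1] with n h5 h6 h7 h8 hn
    have hn1 : (1 : ℝ) < n := by exact_mod_cast hn
    have hn' : (0 : ℝ) < n := by linarith
    have hlog : 0 < Real.log n := Real.log_pos hn1
    refine (measure_mono h5).trans ((measure_union_le _ _).trans (add_le_add ?_ h6))
    have hT := h8.2.2.1
    have hσs : σ n ^ 2 ≤ s ^ 2 := pow_le_pow_left₀ (hσ n).le (hσ' n) 2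
    refine ((hdata n).measure_deviation_le (hC n).posSemidef exchangeableCov_apply_self (V := V)
      (by linarith) (by positivity) (by linarith)
      (by linarith [sq_nonneg s])).trans (ENNReal.ofReal_le_ofReal ?_)
    have hcard : (Fintype.card (Fin (q n) ⊕ Fin (r n)) : ℝ) ≤ c₀ * (n : ℝ) ^ κ := by
      rw [Real.norm_of_nonneg (by positivity), Real.norm_of_nonneg (by positivity)] at h7
      simpa using h7
    have hexp : Real.exp (-(n * (M * √(Real.log n / n)) ^ 2 / W)) ≤
        (n : ℝ) ^ (-(2 * κ + 1)) := by
      rw [Real.rpow_def_of_pos hn', Real.exp_le_exp, mul_pow, Real.sq_sqrt (by positivity)]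
      have e : (n : ℝ) * (M ^ 2 * (Real.log n / n)) / W = Real.log n * (M ^ 2 / W) := by
        field_simp
      rw [e, mul_neg, neg_le_neg_iff]
      gcongr
      rw [le_div_iff₀ hW0]
      linarith
    calc _ ≤ 8 * (c₀ * (n : ℝ) ^ κ) ^ 2 * (n : ℝ) ^ (-(2 * κ + 1)) := by gcongr
      _ = 8 * c₀ ^ 2 * (((n : ℝ) ^ κ * (n : ℝ) ^ κ) * (n : ℝ) ^ (-(2 * κ + 1))) := by ring
      _ = _ := by
        rw [← Real.rpow_add hn', ← Real.rpow_add hn']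
        ring_nf
  have hlim : Tendsto (fun n : ℕ => ENNReal.ofReal (8 * c₀ ^ 2 * (n : ℝ) ^ (-1 : ℝ)) +
      ENNReal.ofReal (K₁ * (n : ℝ) ^ (-1 : ℝ))) atTop (𝓝 0) := by
    have h5 : Tendsto (fun n : ℕ => (n : ℝ) ^ (-1 : ℝ)) atTop (𝓝 0) :=
      (tendsto_rpow_neg_atTop one_pos).comp tendsto_natCast_atTop_atTop
    have h6 (A : ℝ) : Tendsto (fun n : ℕ => ENNReal.ofReal (A * (n : ℝ) ^ (-1 : ℝ))) atTop
        (𝓝 0) := by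
      have := ENNReal.tendsto_ofReal (h5.const_mul A)
      simpa using this
    simpa using (h6 _).add (h6 K₁)
  exact tendsto_of_tendsto_of_tendsto_of_le_of_le' tendsto_const_nhds hlim
    (Eventually.of_forall fun _ => zero_le) hbound

theorem corollary1 {Ω : Type*} [MeasurableSpace Ω] (μ : Measure Ω) [IsProbabilityMeasure μ]
    -- numbers of relevant and of irrelevant covariates, and the covariance matrix
    (q r : ℕ → ℕ) (hq : Tendsto q atTop atTop) (hr : Tendsto r atTop atTop)
    (α₁ α₂ α₃ : ℝ) (hα₁ : α₁ ∈ Set.Ioo (-1 : ℝ) 1) (hα₃ : α₃ ∈ Set.Ioo (-1 : ℝ) 1)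
    (hC : ∀ n, (exchangeableCov (q n) (r n) α₁ α₂ α₃).PosDef)
    -- coefficients, noise level, SPACs
    (β : ∀ n, Fin (q n) ⊕ Fin (r n) → ℝ)
    (hβ₁ : ∀ n i, β n (Sum.inl i) ≠ 0) (hβ₂ : ∀ n j, β n (Sum.inr j) = 0)
    (hm : Tendsto (fun n => signImbalance (β n)) atTop atTop)
    (σ : ℕ → ℝ) (hσ : ∀ n, 0 < σ n) (hσ' : ∃ s : ℝ, ∀ n, σ n ≤ s)
    (γ : ∀ n, Fin (q n) ⊕ Fin (r n) → ℝ)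
    (hγ : ∀ n j, γ n j =
      spac (jointCov (exchangeableCov (q n) (r n) α₁ α₂ α₃) (β n) (σ n)) j)
    -- the condition on the correlations
    (η : ℝ) (hη : 0 < η)
    (hcond : ((|α₂| : ℝ) : EReal) ≤
      (((1 - η) * √((1 - α₁) / (1 - α₃)) * α₁ : ℝ) : EReal) *
        liminf (fun n => (((q n : ℝ) / (signImbalance (β n) : ℝ) : ℝ) : EReal)) atTop)
    -- the data and the estimator of the diagonal of the precision matrix
    (x : ∀ n, Ω → Fin n → EuclideanSpace ℝ (Fin (q n) ⊕ Fin (r n)))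
    (ε : ∀ n, Ω → Fin n → ℝ)
    (hdata : ∀ n, IsGaussianSample μ (exchangeableCov (q n) (r n) α₁ α₂ α₃) (σ n) (x n) (ε n))
    (dhat : ∀ n, Ω → Fin (q n) ⊕ Fin (r n) → ℝ)
    (hdhat : PrecisionEstimatorAccurate μ q r
      (fun n => exchangeableCov (q n) (r n) α₁ α₂ α₃) dhat)
    -- growth conditions on dimensions, signal strength and tuning parameters
    (κ : ℝ) (hκ : 0 ≤ κ)
    (hp : (fun n => ((q n + r n : ℕ) : ℝ)) =O[atTop] fun n : ℕ => (n : ℝ) ^ κ)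
    (hqn : (fun n => (q n : ℝ)) =o[atTop] fun n : ℕ => ((n : ℝ) / Real.log n) ^ (1 / 3 : ℝ))
    (l : ℕ → ℝ) (hl : ∀ n, 0 < l n) (hγl : ∀ n i, l n ≤ |γ n (Sum.inl i)|)
    (lam : ℕ → ℝ) (hlam : ∀ n, 0 ≤ lam n)
    (hlam₁ : (fun n : ℕ => √((q n : ℝ) * n * Real.log n)) =o[atTop] lam)
    (hlam₂ : Tendsto (fun n : ℕ => √(q n : ℝ) * lam n / n) atTop (𝓝 0))
    (hlam₃ : (fun n : ℕ => √(q n : ℝ) * lam n / n) =o[atTop] l) :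
    TransformedStrongIrrepresentable q r (fun n => exchangeableCov (q n) (r n) α₁ α₂ α₃) γ ∧
      SignConsistentAlong μ q r x (fun n ω => response (x n ω) (β n) (ε n ω)) dhat γ lam ∧
      StronglySignConsistent μ q r x (fun n ω => response (x n ω) (β n) (ε n ω)) dhat γ := by
  obtain ⟨hn₁, hn₃, h₂⟩ := exchangeable_parameters_of_posDef hq hr hC
  obtain ⟨s, hs⟩ := hσ'
  obtain ⟨η', hη', hirrep⟩ := eventually_exchangeable_irrep_le hq hr hm hα₁.2 hα₃.2 hn₁ hn₃ h₂
    hη hcond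
  have hcons := signConsistentAlong_of_irrep μ q r hq hr α₁ α₂ α₃ hα₁.2 hα₃.2 hC β hβ₂ σ hσ s hs γ
    hγ hη' hirrep x ε hdata dhat hdhat κ hκ hp hqn l hl hγl lam hlam hlam₁ hlam₃
  refine ⟨⟨η', hη', ?_⟩, hcons, lam, hlam, hcons⟩
  filter_upwards [hirrep, eventually_half_le_exchangeablePrecDiag (r := r) hq hα₁.2 hα₃.2 hn₁ hn₃
    h₂, eventually_half_le_exchangeablePrecDiag (r := q) hr hα₃.2 hα₁.2 hn₃ hn₁
        (h₂.trans_eq (mul_comm α₁ α₃))] with n hir ha hb j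
  obtain ⟨hinv1, hinv2⟩ := exchangeableCov_inv (q := q n) (r := r n) hα₁.2 hα₃.2
    (exchangeable_det_pos hα₁.2 hα₃.2 hn₁ hn₃ h₂).ne'
  have hα : 0 < 1 - α₁ := by linarith [hα₁.2]
  rw [abs_transformedIrrepVector (β := β n) (hC n) (by positivity) (by linarith [ha.1]) hinv1 hinv2
    (fun j => by rw [hγ, sign_spac_jointCov (hC n) _ (hσ n)]) j,
    div_le_iff₀ (Real.sqrt_pos.2 (by linarith [hb.1]))]
  exact hir
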